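/- **Setting.** Let $G$ be a finite simple connected graph with positive edge weights $\omega:E(G)\to\mathbb R^+$; put $\omega(uv)=0$ if $uv\notin E(G)$. Let $L(G)$ be its Laplacian matrix (diagonal matrix of weighted degrees minus weighted adjacency matrix), and let $\tau(G)=\sum_T\prod_{e\in T}\omega(e)$, the sum being over all spanning trees $T$ of $G$; the same notation is used for weighted graphs with arbitrary real weights. For a weighted digraph $D$ and a vertex $u$, $\tau(D,u)$ is the sum, over all directed spanning trees of $D$ with root $u$ (connected spanning subdigraphs in which $u$ has out-degree $0$ and every other vertex has out-degree $1$), of the product of the weights of the arcs. Parallel edges or arcs are replaced by one whose weight is the sum of their weights. Let $N\ge 2$, and let $G$ be $(1,N)$-periodic: there is an automorphism $\sigma$ of $G$ of order $N$ that preserves the weights and such that every vertex $v$ satisfies either $\sigma(v)=v$ or $\sigma^i(v)\ne v$ for all $1\le i<N$. Let $S$ be the subgraph induced by the vertices fixed by $\sigma$, and assume that $S$ is nonempty. Let $H_0$ be an induced subgraph of $G-S$ such that the vertex sets of $H_i=\sigma^i(H_0)$, $0\le i<N$, partition the vertex set of $G-S$. Write $v_1^{(0)},\dots,v_m^{(0)}$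 for the vertices of $H_0$ and $v_x^{(i)}=\sigma^i(v_x^{(0)})$. Let $L_S$ be the principal submatrix of $L(G)$ on $V(S)$, and let $B=(\omega(s\,v_x^{(0)}))_{s\in V(S),\,1\le x\le m}$. Let $\theta\in\mathbb C$ be a primitive $N$-th root of unity. *The weighted graph $H_0^*$* is obtained from $H_0$ as follows. 1. For each edge $e=v_x^{(0)}v_y^{(i)}\in E(G)$ with $1\le i\le\lfloor N/2\rfloor$ and $x\ne y$, add an edge $v_x^{(0)}v_y^{(0)}$ of weight $\omega(e)$ if $i\ne N/2$, and of weight $\omega(e)/2$ if $i=N/2$. 2. For each pair of distinct vertices $v_x^{(0)},v_y^{(0)}$ of $H_0$ that both have a neighbour in $S$, add an edge $v_x^{(0)}v_y^{(0)}$ of weight $N\,(B^{T}L_S^{-1}B)_{xy}$. *The weighted digraph $D_t$* ($1\le t\le N-1$) is obtained from $H_0$ as follows. 1. Replace each edge $e=v_x^{(0)}v_y^{(0)}$ of $H_0$ by the two arcs $(v_x^{(0)},v_y^{(0)})$, $(v_y^{(0)},v_x^{(0)})$, each of weight $\omega(e)$. 2. Add a new vertex $u$. 3. For each edge $e=v_x^{(0)}v_y^{(i)}\in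 E(G)$ with $1\le i\le\lfloor N/2\rfloor$ and $x\ne y$: if $i\neq N/2$, add the arcs $(v_x^{(0)},u)$, $(v_y^{(0)},u)$, $(v_x^{(0)},v_y^{(0)})$, $(v_y^{(0)},v_x^{(0)})$ with weights $(1-\theta^{it})\omega(e)$, $(1-\theta^{-it})\omega(e)$, $\theta^{it}\omega(e)$, $\theta^{-it}\omega(e)$, respectively; if $i=N/2$, add the arcs $(v_x^{(0)},u)$, $(v_x^{(0)},v_y^{(0)})$ with weights $(1-\theta^{Nt/2})\omega(e)$, $\theta^{Nt/2}\omega(e)$, respectively. 4. For each edge $e=v_x^{(0)}v_x^{(i)}\in E(G)$ with $1\le i\le\lfloor N/2\rfloor$, add an arc $(v_x^{(0)},u)$ of weight $(2-\theta^{it}-\theta^{-it})\omega(e)$ if $i\ne N/2$, and of weight $(1-\theta^{Nt/2})\omega(e)$ if $i=N/2$. 5. For each edge $e=v_x^{(0)}s\in E(G)$ with $s\in V(S)$, add an arc $(v_x^{(0)},u)$ of weight $\omega(e)$. In steps 1 of $H_0^*$ and 3 of $D_t$ with $i=N/2$, the edges $v_x^{(0)}v_y^{(N/2)}$ and $v_y^{(0)}v_x^{(N/2)}$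 are both considered, each with its own pair $(x,y)$. **Theorem.** Then $$\tau(G)=\frac{\det(L_S)}{N}\cdot\tau(H_0^*)\prod_{t=1}^{N-1}\tau(D_t,u).$$ -/

import Mathlib

open scoped Matrix

noncomputable section

/-- A weighted simple graph on `V` with weights in `R`. Only the values of `weight` on the edges of
`graph` are meaningful, and no definition below looks at the other ones. -/
structure WGraph (V R : Type*) where
  graph : SimpleGraph V
  weight : Sym2 V → R

namespace WGraph

variable {V R : Type*}

open Classical in
/-- `ω(uv)`, with the convention that it is `0` when `uv` is not an edge. -/
def wt [Zero R] (G : WGraph V R) (u v : V) : R :=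
  if G.graph.Adj u v then G.weight s(u, v) else 0

theorem wt_comm [Zero R] (G : WGraph V R) (u v : V) : G.wt u v = G.wt v u := by
  unfold wt
  by_cases h : G.graph.Adj u v
  · rw [if_pos h, if_pos h.symm, Sym2.eq_swap]
  · rw [if_neg h, if_neg fun h' => h h'.symm]

/-- The weighted degree of a vertex. -/
def deg [Fintype V] [AddCommMonoid R] (G : WGraph V R) (v : V) : R := ∑ u, G.wt v u

/-- The (weighted) adjacency matrix; its diagonal is zero since the graph has no loops. -/
def adjMat [Zero R] (G : WGraph V R) : Matrix V V R := Matrix.of fun u v => G.wt u v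

/-- The Laplacian matrix: diagonal matrix of weighted degrees minus adjacency matrix. -/
def lap [Fintype V] [DecidableEq V] [AddCommGroup R] (G : WGraph V R) : Matrix V V R :=
  Matrix.diagonal G.deg - G.adjMat

theorem lap_transpose [Fintype V] [DecidableEq V] [AddCommGroup R] (G : WGraph V R) :
    G.lapᵀ = G.lap := by
  unfold lap
  rw [Matrix.transpose_sub, Matrix.diagonal_transpose]
  congr 1
  ext u v
  exact G.wt_comm v u

open Classical in
/-- The spanning trees of `G`, each given by its set `F ⊆ E(G)` of edges. -/
def spanningTrees [Fintype V] (G : WGraph V R) : Finset (Finset (Sym2 V)) :=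
  Finset.univ.filter fun F =>
    (F : Set (Sym2 V)) ⊆ G.graph.edgeSet ∧ (SimpleGraph.fromEdgeSet (F : Set (Sym2 V))).IsTree

/-- `τ(G)`: the sum over the spanning trees of the product of the weights of their edges. -/
def tau [Fintype V] [CommSemiring R] (G : WGraph V R) : R :=
  ∑ F ∈ G.spanningTrees, ∏ e ∈ F, G.weight e

end WGraph

/-- A weighted digraph on `V` without multiple arcs. Only the values of `weight` on the arcs are
meaningful, and no definition below looks at the other ones. -/
structure WDigraph (V R : Type*) where
  graph : Digraph V
  weight : V → V → R

namespace WDigraph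

variable {V R : Type*}

open Classical in
/-- The directed spanning trees of `D` with root `r`, each given by its set `F` of arcs: connected
spanning subdigraphs in which `r` has out-degree `0` and every other vertex has out-degree `1`. -/
def rootedSpanningTrees [Fintype V] (D : WDigraph V R) (r : V) : Finset (Finset (V × V)) :=
  Finset.univ.filter fun F =>
    (∀ a ∈ F, D.graph.Adj a.1 a.2) ∧
    (SimpleGraph.fromRel fun x y => (x, y) ∈ F).Connected ∧
    ∀ x, (F.filter fun a => a.1 = x).card = if x = r then 0 else 1

/-- `τ(D, r)`: the sum over the directed spanning trees with root `r` of the product of the weights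
of their arcs. -/
def tau [Fintype V] [CommSemiring R] (D : WDigraph V R) (r : V) : R :=
  ∑ F ∈ D.rootedSpanningTrees r, ∏ a ∈ F, D.weight a.1 a.2

end WDigraph

section Periodic

variable {V : Type*} [Fintype V] [DecidableEq V]

/-- `σ` is an automorphism of the weighted graph `G` that exhibits `G` as a `(1, N)`-periodic graph:
it has order `N`, and every vertex is either fixed by `σ` or moved by each of
`σ, σ², …, σ^(N-1)`. -/
structure IsOneNPeriodic (G : WGraph V ℝ) (N : ℕ) (σ : Equiv.Perm V) : Prop where
  map_adj : ∀ u v, G.graph.Adj (σ u) (σ v) ↔ G.graph.Adj u v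
  map_wt : ∀ u v, G.wt (σ u) (σ v) = G.wt u v
  order : orderOf σ = N
  fixed_or_free : ∀ v, σ v = v ∨ ∀ i : ℕ, 1 ≤ i → i < N → (σ ^ i) v ≠ v

/-- The vertex set of the fixed subgraph `S`. -/
abbrev FixedVertex (σ : Equiv.Perm V) : Type _ := {v : V // σ v = v}

/-- The vertex set `σ ^ i (V(H₀))` of the copy `H_i` of `H₀`. -/
def copy (σ : Equiv.Perm V) (H₀ : Finset V) (i : ℕ) : Finset V := H₀.map (σ ^ i).toEmbedding

/-- `H₀` is (the vertex set of) one of `N` parts `H₀, σ H₀, …, σ^(N-1) H₀` into which `σ`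
partitions the vertices outside the fixed subgraph. -/
structure IsBasePart (N : ℕ) (σ : Equiv.Perm V) (H₀ : Finset V) : Prop where
  disjoint : ∀ i < N, ∀ j < N, i ≠ j → Disjoint (copy σ H₀ i) (copy σ H₀ j)
  cover : (Finset.range N).biUnion (copy σ H₀) = Finset.univ.filter fun v => σ v ≠ v

/-- `L_S`: the principal submatrix of the Laplacian matrix of `G` on the fixed subgraph. -/
def lapS (G : WGraph V ℝ) (σ : Equiv.Perm V) : Matrix (FixedVertex σ) (FixedVertex σ) ℝ :=
  G.lap.submatrix Subtype.val Subtype.val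

/-- `B`: the adjacency matrix between `V(S)` and `V(H₀)`. -/
def matB (G : WGraph V ℝ) (σ : Equiv.Perm V) (H₀ : Finset V) : Matrix (FixedVertex σ) H₀ ℝ :=
  Matrix.of fun s x => G.wt s x

/-- `R_i`: the adjacency matrix between `V(H₀)` and `V(H_i)`; the vertex of `H_i` with the same
label as `y ∈ H₀` is `σ ^ i y`. -/
def matR (G : WGraph V ℝ) (σ : Equiv.Perm V) (H₀ : Finset V) (i : ℕ) : Matrix H₀ H₀ ℝ :=
  Matrix.of fun x y => G.wt x ((σ ^ i) y)

/-- `Bᵀ L_S⁻¹ B`. -/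
def schurB (G : WGraph V ℝ) (σ : Equiv.Perm V) (H₀ : Finset V) : Matrix H₀ H₀ ℝ :=
  (matB G σ H₀)ᵀ * (lapS G σ)⁻¹ * matB G σ H₀

theorem schurB_comm (G : WGraph V ℝ) (σ : Equiv.Perm V) (H₀ : Finset V) (x y : H₀) :
    schurB G σ H₀ x y = schurB G σ H₀ y x := by
  have h : (schurB G σ H₀)ᵀ = schurB G σ H₀ := by
    have h1 : (lapS G σ)ᵀ = lapS G σ := by
      unfold lapS
      rw [Matrix.transpose_submatrix, G.lap_transpose]
    unfold schurB
    rw [Matrix.transpose_mul, Matrix.transpose_mul, Matrix.transpose_transpose,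
      Matrix.transpose_nonsing_inv, h1, Matrix.mul_assoc]
  exact congrFun (congrFun h y) x

/-- `v` is a neighbour of a vertex of the fixed subgraph. -/
def InNbhdS (G : WGraph V ℝ) (σ : Equiv.Perm V) (v : V) : Prop :=
  ∃ s : V, σ s = s ∧ G.graph.Adj s v

open Classical in
/-- The total weight of the edges `xy` (`x ≠ y`) of `H₀*`: the edge of `H₀`; the edges added for
the edges of `G` joining `x` to `σ ^ i y` and `y` to `σ ^ i x`, `1 ≤ i ≤ ⌊N/2⌋` (with half of
their weights if `i = N/2`); the edge of weight `N (Bᵀ L_S⁻¹ B)_{xy}` for `x`, `y` adjacent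
to `S`. -/
def starWeight (G : WGraph V ℝ) (N : ℕ) (σ : Equiv.Perm V) (H₀ : Finset V) (x y : H₀) : ℝ :=
  G.wt x y
  + ∑ i ∈ Finset.Icc 1 (N / 2),
      (if 2 * i = N then matR G σ H₀ i x y / 2 + matR G σ H₀ i y x / 2
        else matR G σ H₀ i x y + matR G σ H₀ i y x)
  + if InNbhdS G σ x ∧ InNbhdS G σ y then (N : ℝ) * schurB G σ H₀ x y else 0

theorem starWeight_comm (G : WGraph V ℝ) (N : ℕ) (σ : Equiv.Perm V) (H₀ : Finset V) (x y : H₀) :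
    starWeight G N σ H₀ x y = starWeight G N σ H₀ y x := by
  unfold starWeight
  refine congrArg₂ _ (congrArg₂ _ (G.wt_comm _ _) ?_) ?_
  · refine Finset.sum_congr rfl fun i _ => ?_
    split_ifs
    · exact add_comm _ _
    · exact add_comm _ _
  · rw [schurB_comm G σ H₀ x y]
    by_cases h : InNbhdS G σ x ∧ InNbhdS G σ y
    · rw [if_pos h, if_pos h.symm]
    · rw [if_neg h, if_neg fun h' => h h'.symm]

/-- The weighted graph `H₀*` on the vertices of `H₀`, with parallel edges merged into one edge that
carries the sum of their weights. -/
def starGraph (G : WGraph V ℝ) (N : ℕ) (σ : Equiv.Perm V) (H₀ : Finset V) : WGraph H₀ ℝ where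
  graph := SimpleGraph.fromRel fun x y : H₀ =>
    G.graph.Adj x y ∨
    (∃ i ∈ Finset.Icc 1 (N / 2), G.graph.Adj x ((σ ^ i) y)) ∨
    (InNbhdS G σ x ∧ InNbhdS G σ y)
  weight := Sym2.lift ⟨starWeight G N σ H₀, starWeight_comm G N σ H₀⟩

/-- The total weight of the arcs `(x, y)` of `D_j`, for distinct vertices `x`, `y` of `H₀`. -/
def arcWeight (G : WGraph V ℝ) (N : ℕ) (σ : Equiv.Perm V) (H₀ : Finset V) (θ : ℂ) (j : ℕ)
    (x y : H₀) : ℂ :=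
  (G.wt x y : ℂ)
  + ∑ i ∈ Finset.Icc 1 (N / 2),
      (if 2 * i = N then θ ^ (i * j) * (matR G σ H₀ i x y : ℂ)
        else θ ^ (i * j) * (matR G σ H₀ i x y : ℂ) + (θ ^ (i * j))⁻¹ * (matR G σ H₀ i y x : ℂ))

/-- The total weight of the arcs `(x, u)` of `D_j` from a vertex `x` of `H₀` to the new vertex `u`.
The three sums come from the edges of `G` joining `H₀` and `H_i` with ends in different orbits,
from those with both ends in the orbit of `x`, and from the edges joining `x` to `S`. -/
def rootWeight (G : WGraph V ℝ) (N : ℕ) (σ : Equiv.Perm V) (H₀ : Finset V) (θ : ℂ) (j : ℕ)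
    (x : H₀) : ℂ :=
  ∑ i ∈ Finset.Icc 1 (N / 2), ∑ y ∈ Finset.univ.filter (fun y : H₀ => y ≠ x),
      (if 2 * i = N then (1 - θ ^ (i * j)) * (matR G σ H₀ i x y : ℂ)
        else (1 - θ ^ (i * j)) * (matR G σ H₀ i x y : ℂ)
          + (1 - (θ ^ (i * j))⁻¹) * (matR G σ H₀ i y x : ℂ))
  + ∑ i ∈ Finset.Icc 1 (N / 2),
      (if 2 * i = N then (1 - θ ^ (i * j)) * (matR G σ H₀ i x x : ℂ)
        else (2 - θ ^ (i * j) - (θ ^ (i * j))⁻¹) * (matR G σ H₀ i x x : ℂ))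
  + ∑ s : FixedVertex σ, (G.wt x s : ℂ)

/-- The weighted digraph `D_j` on the vertices of `H₀` together with the new vertex `u = none`, with
multiple arcs merged into one arc that carries the sum of their weights. -/
def rootedDigraph (G : WGraph V ℝ) (N : ℕ) (σ : Equiv.Perm V) (H₀ : Finset V) (θ : ℂ) (j : ℕ) :
    WDigraph (Option H₀) ℂ where
  graph :=
    { Adj := fun
        | some x, some y => G.graph.Adj x y ∨ (x ≠ y ∧ ∃ i ∈ Finset.Icc 1 (N / 2),
            G.graph.Adj x ((σ ^ i) y) ∨ (2 * i ≠ N ∧ G.graph.Adj y ((σ ^ i) x)))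
        | some x, none => (∃ i ∈ Finset.Icc 1 (N / 2), ∃ y : H₀,
            G.graph.Adj x ((σ ^ i) y) ∨ (2 * i ≠ N ∧ G.graph.Adj y ((σ ^ i) x))) ∨
            InNbhdS G σ x
        | none, _ => False }
  weight := fun
    | some x, some y => arcWeight G N σ H₀ θ j x y
    | some x, none => rootWeight G N σ H₀ θ j x
    | none, _ => 0

end Periodic

end

/-! The Laplacian is singular, but its rank one perturbations are not blind to trees: det(L + abᵀ) =
(∑a)(∑b)τ. Take a = b the indicator of the vertices outside S. With m vertices in H₀ this gives
(mN)²τ(G), and the block L_S is left untouched. Eliminating S by a Schur complement leaves det(L_S)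
times the determinant of a block circulant matrix with blocks L_{0,d} + J − BᵀL_S⁻¹B, where J is the
all-ones matrix (`det_schur`).

The discrete Fourier transform splits this determinant into N factors (`det_block_circulant`). For t
≠ 0 the terms J and BᵀL_S⁻¹B, constant in d, are killed by ∑θ^{dt} = 0; the twisted Laplacian that
remains has determinant τ(D_t, u). For t = 0 the sum of the blocks is L(H₀*) + NJ, of determinant
Nm²τ(H₀*). Cancelling (mN)² gives the formula.

Both matrix tree theorems come from one expansion: a Laplacian-like determinant is a sum over
acyclic parent functions (`det_eq_sum_isRootedForest`). -/

section RootedForest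

/-! ### Acyclic parent functions and determinants. -/

variable {V : Type*}

/-- The partial function `f`, read as "the parent of `x` is `f x`, and `x` is a root if `f x` is
`none`", has no cycle. -/
def IsRootedForest (f : V → Option V) : Prop := WellFounded fun y x => f x = some y

theorem IsRootedForest.of_rank {f : V → Option V} (d : V → ℕ)
    (h : ∀ x y, f x = some y → d y < d x) : IsRootedForest f :=
  Subrelation.wf (fun {y x} hxy => h x y hxy) (InvImage.wf d Nat.lt_wfRel.wf)

theorem IsRootedForest.exists_depth {f : V → Option V} (hf : IsRootedForest f) :
    ∃ d : V → ℕ, ∀ x y, f x = some y → d x = d y + 1 := by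
  let F : ∀ x, (∀ y, f x = some y → ℕ) → ℕ := fun x ih =>
    if h : (f x).isSome then ih ((f x).get h) (by simp) + 1 else 0
  refine ⟨hf.fix F, fun x y hxy => ?_⟩
  rw [hf.fix_eq F x]
  have h : (f x).isSome := by simp [hxy]
  simp only [F, dif_pos h]
  congr 2
  simp [hxy]

variable [Fintype V] [DecidableEq V]

open Classical in
-- Without cycles, sorting by depth makes the matrix unitriangular: parents lie exactly one level
-- lower. Otherwise it has a nonzero kernel vector.
theorem det_one_sub_parent {R : Type*} [CommRing R] [IsDomain R] (f : V → Option V) :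
    (Matrix.of fun x y : V => (if x = y then (1 : R) else 0) - if f x = some y then 1 else 0).det
      = if IsRootedForest f then 1 else 0 := by
  split_ifs with hf
  · obtain ⟨d, hd⟩ := hf.exists_depth
    rw [← Matrix.det_transpose]
    have ht : Matrix.BlockTriangular (Matrix.of fun x y : V => (if x = y then (1 : R) else 0) -
        if f x = some y then 1 else 0)ᵀ d := by
      intro i j hij
      have h1 : j ≠ i := by rintro rfl; exact lt_irrefl _ hij
      have h2 : f j ≠ some i := fun h => by have := hd _ _ h; omega
      simp [Matrix.transpose_apply, h1, h2]
    rw [ht.det]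
    refine Finset.prod_eq_one fun a _ => ?_
    rw [← Matrix.det_one (n := { x // d x = a }) (R := R)]
    congr 1
    ext ⟨i, hi⟩ ⟨j, hj⟩
    have h2 : f j ≠ some i := fun h => by have := hd _ _ h; omega
    simp [Matrix.toSquareBlock_def, Matrix.one_apply, h2, eq_comm]
  · rw [← Matrix.exists_mulVec_eq_zero_iff]
    -- The indicator of the vertices whose chain of parents never ends: it takes the same value at a
    -- vertex and at its parent, and vanishes at roots.
    refine ⟨fun x => if Acc (fun y x => f x = some y) x then 0 else 1, ?_, ?_⟩
    · intro h0
      refine hf ⟨fun x => ?_⟩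
      by_contra hx
      have := congrFun h0 x
      simp [hx] at this
    · ext x
      simp only [Matrix.mulVec, dotProduct, Matrix.of_apply, sub_mul, Finset.sum_sub_distrib,
        ite_mul, one_mul, zero_mul, Finset.sum_ite_eq, Finset.mem_univ, if_true, Pi.zero_apply]
      rcases hx : f x with _ | y
      · have : Acc (fun y x => f x = some y) x := ⟨_, fun y hy => by simp [hx] at hy⟩
        simp [this]
      · have : Acc (fun y x => f x = some y) x ↔ Acc (fun y x => f x = some y) y :=
          ⟨fun h => h.inv hx, fun h => ⟨_, fun z hz => by
            have : y = z := by rw [hx] at hz; exact Option.some.inj hz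
            exact this ▸ h⟩⟩
        simp [this]

open Classical in
/-- The matrix tree theorem, in terms of parent functions. -/
theorem det_eq_sum_isRootedForest {R : Type*} [CommRing R] [IsDomain R] (w : V → Option V → R) :
    (Matrix.of fun x y : V => (if x = y then ∑ o, w x o else 0) - w x (some y)).det
      = ∑ f with IsRootedForest f, ∏ x, w x (f x) := by
  -- Row x is the combination of the vectors e_x − e_o with coefficients w x o, where e_none = 0;
  -- multilinearity then chooses a parent o for every x.
  have hrow : (Matrix.of fun x y : V => (if x = y then ∑ o, w x o else 0) - w x (some y))
      = fun x => ∑ o, w x o •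
        fun y : V => (if x = y then (1 : R) else 0) - if o = some y then 1 else 0 := by
    ext x y
    simp only [Matrix.of_apply, Finset.sum_apply, Pi.smul_apply, smul_eq_mul, mul_sub,
      Finset.sum_sub_distrib]
    congr 1
    · split_ifs <;> simp
    · simp
  rw [hrow]
  have := (Matrix.detRowAlternating (n := V) (R := R)).toMultilinearMap.map_sum
    (fun (x : V) (o : Option V) => w x o •
        fun y : V => (if x = y then (1 : R) else 0) - if o = some y then 1 else 0)
  refine this.trans ?_
  rw [Finset.sum_filter]
  refine Finset.sum_congr rfl fun f _ => ?_
  rw [MultilinearMap.map_smul_univ]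
  have h := det_one_sub_parent (R := R) f
  refine (congrArg _ h).trans ?_
  split_ifs <;> simp

end RootedForest

/-! ### The matrix tree theorem for digraphs. -/

namespace WDigraph

variable {V R : Type*}

open Classical in
/-- The weight of the arc from `some x` to `o`, or `0` if there is no such arc. -/
noncomputable def arc [Zero R] (D : WDigraph (Option V) R) (x : V) (o : Option V) : R :=
  if D.graph.Adj (some x) o then D.weight (some x) o else 0

variable [Fintype V]

/-- The arcs from vertices to their parents. -/
def parentArcs (f : V → Option V) : Finset (Option V × Option V) :=
  Finset.univ.map ⟨fun x => (some x, f x), fun x y h => by simpa using congrArg Prod.fst h⟩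

theorem mem_parentArcs {f : V → Option V} {a : Option V × Option V} :
    a ∈ parentArcs f ↔ ∃ x, (some x, f x) = a := by
  simp only [parentArcs, Finset.mem_map, Finset.mem_univ, true_and]
  rfl

variable [DecidableEq V]

theorem connected_parentArcs_iff (f : V → Option V) :
    (SimpleGraph.fromRel fun x y => (x, y) ∈ parentArcs f).Connected ↔ IsRootedForest f := by
  constructor
  · intro h
    -- "The chain of parents ends" is invariant along edges and holds at the root `none`, so
    -- connectedness spreads it everywhere.
    let P : Option V → Prop := fun o => ∀ x, o = some x → Acc (fun y x => f x = some y) x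
    have hstep : ∀ x, P (some x) ↔ P (f x) := by
      intro x
      refine ⟨fun h y hy => (h x rfl).inv hy, fun h z hz => ?_⟩
      obtain rfl := Option.some.inj hz
      exact ⟨_, fun y hy => h y hy⟩
    have hadj : ∀ a b, (SimpleGraph.fromRel fun x y => (x, y) ∈ parentArcs f).Adj a b →
        (P a ↔ P b) := by
      intro a b hab
      rw [SimpleGraph.fromRel_adj] at hab
      rcases hab.2 with h | h <;> obtain ⟨x, hx⟩ := mem_parentArcs.1 h <;>
        simp only [Prod.mk.injEq] at hx <;> obtain ⟨rfl, rfl⟩ := hx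
      · exact hstep x
      · exact (hstep x).symm
    have hall : ∀ a b, (SimpleGraph.fromRel fun x y => (x, y) ∈ parentArcs f).Walk a b →
        (P a ↔ P b) := by
      intro a b p
      induction p with
      | nil => rfl
      | cons h _ ih => exact (hadj _ _ h).trans ih
    refine ⟨fun x => ?_⟩
    obtain ⟨p⟩ := h.preconnected none (some x)
    exact (hall _ _ p).1 (fun _ h => by simp at h) x rfl
  · intro hf
    have hreach : ∀ x, (SimpleGraph.fromRel fun x y => (x, y) ∈ parentArcs f).Reachable
        (some x) none := by
      intro x
      induction x using hf.induction with
      | _ x ih =>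
        by_cases hne : some x = f x
        · exact ih x hne.symm
        have hadj : (SimpleGraph.fromRel fun x y => (x, y) ∈ parentArcs f).Adj (some x) (f x) := by
          rw [SimpleGraph.fromRel_adj]
          exact ⟨hne, Or.inl (mem_parentArcs.2 ⟨x, rfl⟩)⟩
        rcases hx : f x with _ | y
        · exact hx ▸ hadj.reachable
        · exact (hx ▸ hadj.reachable).trans (ih y hx)
    have hreach' : ∀ o, (SimpleGraph.fromRel fun x y => (x, y) ∈ parentArcs f).Reachable
        o none := by
      rintro (_ | x)
      · rfl
      · exact hreach x
    exact ⟨fun a b => (hreach' a).trans (hreach' b).symm⟩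

theorem card_filter_parentArcs (f : V → Option V) (o : Option V) :
    ((parentArcs f).filter fun a => a.1 = o).card = if o = none then 0 else 1 := by
  rcases o with _ | x
  · rw [if_pos rfl, Finset.card_eq_zero, Finset.filter_eq_empty_iff]
    intro a ha
    obtain ⟨x, rfl⟩ := mem_parentArcs.1 ha
    simp
  · rw [if_neg (by simp), Finset.card_eq_one]
    refine ⟨(some x, f x), ?_⟩
    ext a
    rw [Finset.mem_filter, mem_parentArcs, Finset.mem_singleton]
    constructor
    · rintro ⟨⟨y, rfl⟩, hy⟩
      obtain rfl := Option.some.inj hy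
      rfl
    · rintro rfl
      exact ⟨⟨x, rfl⟩, rfl⟩

/-- The out-degree conditions say precisely that the arc set is the graph of a function. -/
theorem exists_eq_parentArcs {F : Finset (Option V × Option V)}
    (hF : ∀ x, (F.filter fun a => a.1 = x).card = if x = none then 0 else 1) :
    ∃ f, parentArcs f = F := by
  have h1 : ∀ x : V, ∃ o, F.filter (fun a => a.1 = some x) = {(some x, o)} := by
    intro x
    have := hF (some x)
    rw [if_neg (by simp), Finset.card_eq_one] at this
    obtain ⟨⟨a, o⟩, ha⟩ := this
    have hm : (a, o) ∈ F.filter (fun a => a.1 = some x) := ha ▸ Finset.mem_singleton_self _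
    have : a = some x := (Finset.mem_filter.1 hm).2
    exact ⟨o, this ▸ ha⟩
  choose f hf using h1
  refine ⟨f, ?_⟩
  ext ⟨a, o⟩
  rw [mem_parentArcs]
  rcases a with _ | x
  · have := hF none
    rw [if_pos rfl, Finset.card_eq_zero, Finset.filter_eq_empty_iff] at this
    constructor
    · rintro ⟨x, hx⟩
      simp at hx
    · intro h
      exact absurd rfl (this h)
  · have hm : (some x, o) ∈ F ↔ (some x, o) ∈ F.filter (fun a => a.1 = some x) := by simp
    rw [hm, hf]
    simp [eq_comm]

theorem mem_rootedSpanningTrees {D : WDigraph V R} {r : V} {F : Finset (V × V)} :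
    F ∈ D.rootedSpanningTrees r ↔ (∀ a ∈ F, D.graph.Adj a.1 a.2) ∧
      (SimpleGraph.fromRel fun x y => (x, y) ∈ F).Connected ∧
      ∀ x, (F.filter fun a => a.1 = x).card = if x = r then 0 else 1 := by
  simp only [rootedSpanningTrees, Finset.mem_filter, Finset.mem_univ, true_and]
  refine and_congr_right fun _ => and_congr_right fun _ => forall_congr' fun x => ?_
  convert Iff.rfl

/-- The matrix tree theorem for digraphs. -/
theorem tau_none_eq_det [CommRing R] [IsDomain R] (D : WDigraph (Option V) R) :
    D.tau none = (Matrix.of fun x y : V =>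
      (if x = y then ∑ o, D.arc x o else 0) - D.arc x (some y)).det := by
  classical
  rw [det_eq_sum_isRootedForest]
  -- A parent function using a missing arc contributes zero.
  have hrest : ∑ f : V → Option V with IsRootedForest f, ∏ x, D.arc x (f x)
      = ∑ f : V → Option V with (IsRootedForest f ∧ ∀ x, D.graph.Adj (some x) (f x)),
        ∏ x, D.arc x (f x) := by
    symm
    refine Finset.sum_subset (fun f hf => ?_) (fun f hf hf' => ?_)
    · simp only [Finset.mem_filter, Finset.mem_univ, true_and] at hf ⊢
      exact hf.1
    · simp only [Finset.mem_filter, Finset.mem_univ, true_and] at hf hf'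
      have : ∃ x, ¬ D.graph.Adj (some x) (f x) := by
        by_contra! h
        exact hf' ⟨hf, h⟩
      obtain ⟨x, hx⟩ := this
      exact Finset.prod_eq_zero (Finset.mem_univ x) (if_neg hx)
  rw [hrest, tau]
  symm
  refine Finset.sum_bij (fun f _ => parentArcs f) ?_ ?_ ?_ ?_
  · intro f hf
    simp only [Finset.mem_filter, Finset.mem_univ, true_and] at hf
    refine mem_rootedSpanningTrees.2 ⟨?_, (connected_parentArcs_iff f).2 hf.1, ?_⟩
    · intro a ha
      obtain ⟨x, rfl⟩ := mem_parentArcs.1 ha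
      exact hf.2 x
    · exact card_filter_parentArcs f
  · intro f _ g _ h
    ext1 x
    have : (some x, f x) ∈ parentArcs g := h ▸ mem_parentArcs.2 ⟨x, rfl⟩
    obtain ⟨y, hy⟩ := mem_parentArcs.1 this
    simp only [Prod.mk.injEq, Option.some.injEq] at hy
    rw [← hy.2, hy.1]
  · intro F hF
    obtain ⟨hadj, hc, hd⟩ := mem_rootedSpanningTrees.1 hF
    obtain ⟨f, rfl⟩ := exists_eq_parentArcs hd
    refine ⟨f, ?_, rfl⟩
    simp only [Finset.mem_filter, Finset.mem_univ, true_and]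
    exact ⟨(connected_parentArcs_iff f).1 hc, fun x => hadj _ (mem_parentArcs.2 ⟨x, rfl⟩)⟩
  · intro f hf
    simp only [Finset.mem_filter, Finset.mem_univ, true_and] at hf
    rw [parentArcs, Finset.prod_map]
    exact Finset.prod_congr rfl fun x _ => if_pos (hf.2 x)

end WDigraph

/-! ### Spanning trees of a graph as parent functions. -/

section ParentEdges

variable {V : Type*} [Fintype V] [DecidableEq V]

/-- The edges between vertices and their parents. -/
def parentEdges (f : V → Option V) : Finset (Sym2 V) :=
  (Finset.univ.filter fun x => (f x).isSome).image fun x => s(x, (f x).getD x)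

theorem mem_parentEdges {f : V → Option V} {e : Sym2 V} :
    e ∈ parentEdges f ↔ ∃ x y, f x = some y ∧ s(x, y) = e := by
  simp only [parentEdges, Finset.mem_image, Finset.mem_filter, Finset.mem_univ, true_and]
  constructor
  · rintro ⟨x, hx, rfl⟩
    obtain ⟨y, hy⟩ := Option.isSome_iff_exists.1 hx
    exact ⟨x, y, hy, by simp [hy]⟩
  · rintro ⟨x, y, hy, rfl⟩
    exact ⟨x, by simp [hy], by simp [hy]⟩

/-- Two vertices sharing a parent edge would be parents of each other, contradicting depth. -/
theorem IsRootedForest.injOn_edge {f : V → Option V} (hf : IsRootedForest f) :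
    Set.InjOn (fun x => s(x, (f x).getD x))
      (Finset.univ.filter fun x => (f x).isSome : Finset V) := by
  obtain ⟨d, hd⟩ := hf.exists_depth
  intro x hx y hy hxy
  simp only [Finset.coe_filter, Finset.mem_univ, true_and, Set.mem_ofPred_eq] at hx hy
  obtain ⟨a, ha⟩ := Option.isSome_iff_exists.1 hx
  obtain ⟨b, hb⟩ := Option.isSome_iff_exists.1 hy
  simp only [ha, hb, Option.getD_some, Sym2.eq_iff] at hxy
  rcases hxy with h | ⟨rfl, rfl⟩
  · exact h.1
  · have := hd _ _ ha
    have := hd _ _ hb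
    omega

theorem IsRootedForest.prod_parentEdges {R : Type*} [CommMonoid R] {f : V → Option V}
    (hf : IsRootedForest f) (w : Sym2 V → R) :
    ∏ e ∈ parentEdges f, w e = ∏ x, (f x).elim 1 fun y => w s(x, y) := by
  rw [parentEdges, Finset.prod_image hf.injOn_edge, Finset.prod_filter]
  refine Finset.prod_congr rfl fun x _ => ?_
  rcases f x with _ | y <;> simp

theorem IsRootedForest.card_parentEdges {f : V → Option V} (hf : IsRootedForest f) {v : V}
    (hv : ∀ x, f x = none ↔ x = v) : (parentEdges f).card + 1 = Fintype.card V := by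
  rw [parentEdges, Finset.card_image_of_injOn hf.injOn_edge]
  have : (Finset.univ.filter fun x => (f x).isSome) = Finset.univ.erase v := by
    ext x
    simp [← hv, ← Option.ne_none_iff_isSome]
  rw [this, Finset.card_erase_of_mem (Finset.mem_univ _), Finset.card_univ]
  have : 0 < Fintype.card V := Fintype.card_pos_iff.2 ⟨v⟩
  omega

theorem fromEdgeSet_parentEdges_adj {f : V → Option V} (hf : IsRootedForest f) {x y : V} :
    (SimpleGraph.fromEdgeSet (parentEdges f : Set (Sym2 V))).Adj x y ↔
      f x = some y ∨ f y = some x := by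
  obtain ⟨d, hd⟩ := hf.exists_depth
  rw [SimpleGraph.fromEdgeSet_adj, Finset.mem_coe, mem_parentEdges]
  constructor
  · rintro ⟨⟨a, b, hab, he⟩, -⟩
    rcases Sym2.eq_iff.1 he with ⟨rfl, rfl⟩ | ⟨rfl, rfl⟩
    · exact Or.inl hab
    · exact Or.inr hab
  · rintro (h | h)
    · exact ⟨⟨x, y, h, rfl⟩, by rintro rfl; have := hd _ _ h; omega⟩
    · exact ⟨⟨y, x, h, Sym2.eq_swap⟩, by rintro rfl; have := hd _ _ h; omega⟩

theorem IsRootedForest.exists_walk {f : V → Option V} (hf : IsRootedForest f) {v : V}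
    (hv : ∀ x, f x = none ↔ x = v) {d : V → ℕ} (hd : ∀ x y, f x = some y → d x = d y + 1) (x : V) :
    ∃ p : (SimpleGraph.fromEdgeSet (parentEdges f : Set (Sym2 V))).Walk x v,
      p.length + d v = d x := by
  induction x using hf.induction with
  | _ x ih =>
    rcases hx : f x with _ | y
    · obtain rfl := (hv x).1 hx
      exact ⟨.nil, by simp⟩
    · obtain ⟨p, hp⟩ := ih y hx
      refine ⟨.cons ((fromEdgeSet_parentEdges_adj hf).2 (Or.inl hx)) p, ?_⟩
      have := hd _ _ hx
      rw [SimpleGraph.Walk.length_cons]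
      omega

theorem IsRootedForest.connected_parentEdges {f : V → Option V} (hf : IsRootedForest f) {v : V}
    (hv : ∀ x, f x = none ↔ x = v) :
    (SimpleGraph.fromEdgeSet (parentEdges f : Set (Sym2 V))).Connected := by
  obtain ⟨d, hd⟩ := hf.exists_depth
  have h : ∀ x, (SimpleGraph.fromEdgeSet (parentEdges f : Set (Sym2 V))).Reachable x v := fun x =>
    let ⟨p, _⟩ := hf.exists_walk hv hd x
    ⟨p⟩
  have : Nonempty V := ⟨v⟩
  exact ⟨fun x y => (h x).trans (h y).symm⟩

omit [Fintype V] [DecidableEq V] in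
theorem card_edgeSet_fromEdgeSet {G : SimpleGraph V} {F : Finset (Sym2 V)}
    (hF : (F : Set (Sym2 V)) ⊆ G.edgeSet) :
    Nat.card (SimpleGraph.fromEdgeSet (F : Set (Sym2 V))).edgeSet = F.card := by
  have : (SimpleGraph.fromEdgeSet (F : Set (Sym2 V))).edgeSet = F := by
    rw [SimpleGraph.edgeSet_fromEdgeSet]
    refine sdiff_eq_left.2 (Set.disjoint_left.2 fun e he hd => ?_)
    exact G.not_isDiag_of_mem_edgeSet (hF he) hd
  rw [this]
  simp

/-- Every edge changes the depth by one, so the chain of parents is a shortest walk to v. The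
orientation of the edges can thus be read off from the unoriented edge set. -/
theorem IsRootedForest.dist_parentEdges {f : V → Option V} (hf : IsRootedForest f) {v : V}
    (hv : ∀ x, f x = none ↔ x = v) {x y : V} (hxy : f x = some y) :
    (SimpleGraph.fromEdgeSet (parentEdges f : Set (Sym2 V))).dist x v =
      (SimpleGraph.fromEdgeSet (parentEdges f : Set (Sym2 V))).dist y v + 1 := by
  obtain ⟨d, hd⟩ := hf.exists_depth
  have hle : ∀ {a b} (p : (SimpleGraph.fromEdgeSet (parentEdges f : Set (Sym2 V))).Walk a b),
      d a ≤ p.length + d b := by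
    intro a b p
    induction p with
    | nil => simp
    | cons h p ih =>
      rw [SimpleGraph.Walk.length_cons]
      rcases (fromEdgeSet_parentEdges_adj hf).1 h with h | h <;> have := hd _ _ h <;> omega
  have hdist : ∀ a, (SimpleGraph.fromEdgeSet (parentEdges f : Set (Sym2 V))).dist a v + d v
      = d a := by
    intro a
    obtain ⟨p, hp⟩ := hf.exists_walk hv hd a
    have h1 := SimpleGraph.dist_le p
    obtain ⟨q, hq⟩ := (hf.connected_parentEdges hv).exists_walk_length_eq_dist a v
    have h2 := hle q
    omega
  have := hdist x
  have := hdist y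
  have := hd _ _ hxy
  omega

theorem parentEdges_injective {f g : V → Option V} (hf : IsRootedForest f) (hg : IsRootedForest g)
    {v : V} (hfv : ∀ x, f x = none ↔ x = v) (hgv : ∀ x, g x = none ↔ x = v)
    (h : parentEdges f = parentEdges g) : f = g := by
  ext1 x
  rcases hx : f x with _ | y
  · exact ((hgv x).2 ((hfv x).1 hx)).symm
  · have hm : s(x, y) ∈ parentEdges g := h ▸ mem_parentEdges.2 ⟨x, y, hx, rfl⟩
    obtain ⟨a, b, hab, he⟩ := mem_parentEdges.1 hm
    rcases Sym2.eq_iff.1 he with ⟨rfl, rfl⟩ | ⟨rfl, rfl⟩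
    · exact hab.symm
    · have h1 := hf.dist_parentEdges hfv hx
      have h2 := hg.dist_parentEdges hgv hab
      rw [← h] at h2
      omega

omit [Fintype V] [DecidableEq V] in
/-- In a connected graph, the parent of a vertex may be chosen to be one step closer to `v`. -/
theorem SimpleGraph.Connected.exists_parent {G : SimpleGraph V} (hG : G.Connected) (v : V) :
    ∃ f : V → Option V, (∀ x, f x = none ↔ x = v) ∧
      ∀ x y, f x = some y → G.Adj x y ∧ G.dist y v < G.dist x v := by
  have h : ∀ x, ∃ o : Option V, (o = none ↔ x = v) ∧
      ∀ y, o = some y → G.Adj x y ∧ G.dist y v < G.dist x v := by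
    intro x
    obtain ⟨p, hp⟩ := hG.exists_walk_length_eq_dist x v
    cases p with
    | nil => exact ⟨none, by simp, by simp⟩
    | cons h q =>
      rename_i y
      refine ⟨some y, ?_, ?_⟩
      · simp only [reduceCtorEq, false_iff]
        rintro rfl
        simp at hp
      · intro z hz
        obtain rfl := Option.some.inj hz
        rw [SimpleGraph.Walk.length_cons] at hp
        have := SimpleGraph.dist_le q
        exact ⟨h, by omega⟩
  choose f hf using h
  exact ⟨f, fun x => (hf x).1, fun x => (hf x).2⟩

end ParentEdges

/-! ### The matrix tree theorem for graphs. -/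

namespace WGraph

variable {V R : Type*} [Fintype V] [DecidableEq V]

theorem lap_apply [AddCommGroup R] (G : WGraph V R) (u v : V) :
    G.lap u v = (if u = v then G.deg u else 0) - G.wt u v := by
  rw [lap, Matrix.sub_apply, Matrix.diagonal_apply]
  rfl

omit [Fintype V] [DecidableEq V] in
theorem wt_self [Zero R] (G : WGraph V R) (v : V) : G.wt v v = 0 :=
  if_neg (G.graph.loopless.irrefl v)

theorem sum_lap_row [AddCommGroup R] (G : WGraph V R) (u : V) : ∑ v, G.lap u v = 0 := by
  simp [lap_apply, Finset.sum_sub_distrib, deg]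

theorem sum_lap_col [AddCommGroup R] (G : WGraph V R) (v : V) : ∑ u, G.lap u v = 0 := by
  rw [← G.sum_lap_row v]
  exact Finset.sum_congr rfl fun u _ => congrFun (congrFun G.lap_transpose v) u

omit [DecidableEq V] in
theorem mem_spanningTrees {G : WGraph V R} {F : Finset (Sym2 V)} :
    F ∈ G.spanningTrees ↔ (F : Set (Sym2 V)) ⊆ G.graph.edgeSet ∧
      (SimpleGraph.fromEdgeSet (F : Set (Sym2 V))).IsTree := by
  simp only [spanningTrees, Finset.mem_filter, Finset.mem_univ, true_and]

theorem parentEdges_mem_spanningTrees {G : WGraph V R} {f : V → Option V} (hf : IsRootedForest f)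
    {v : V} (hv : ∀ x, f x = none ↔ x = v) (hG : ∀ x y, f x = some y → G.graph.Adj x y) :
    parentEdges f ∈ G.spanningTrees := by
  have hsub : (parentEdges f : Set (Sym2 V)) ⊆ G.graph.edgeSet := by
    intro e he
    obtain ⟨x, y, hxy, rfl⟩ := mem_parentEdges.1 he
    exact hG x y hxy
  refine mem_spanningTrees.2 ⟨hsub, ?_⟩
  rw [SimpleGraph.isTree_iff_connected_and_card, card_edgeSet_fromEdgeSet hsub,
    hf.card_parentEdges hv, Nat.card_eq_fintype_card]
  exact ⟨hf.connected_parentEdges hv, rfl⟩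

/-- Sending each vertex one step closer to v gives |V| − 1 distinct edges of F, and a tree has no
more. -/
theorem exists_parentEdges_eq {G : WGraph V R} {F : Finset (Sym2 V)} (hF : F ∈ G.spanningTrees)
    (v : V) : ∃ f : V → Option V, IsRootedForest f ∧ (∀ x, f x = none ↔ x = v) ∧
      (∀ x y, f x = some y → G.graph.Adj x y) ∧ parentEdges f = F := by
  obtain ⟨hsub, hT⟩ := mem_spanningTrees.1 hF
  obtain ⟨f, hv, hf⟩ := hT.connected.exists_parent v
  have hforest : IsRootedForest f := .of_rank _ fun x y hxy => (hf x y hxy).2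
  have hmem : ∀ x y, f x = some y → s(x, y) ∈ F := fun x y hxy =>
    ((SimpleGraph.fromEdgeSet_adj _).1 (hf x y hxy).1).1
  refine ⟨f, hforest, hv, fun x y hxy => hsub (hmem x y hxy), ?_⟩
  refine Finset.eq_of_subset_of_card_le (fun e he => ?_) ?_
  · obtain ⟨x, y, hxy, rfl⟩ := mem_parentEdges.1 he
    exact hmem x y hxy
  · have h1 := hforest.card_parentEdges hv
    have h2 := (SimpleGraph.isTree_iff_connected_and_card.1 hT).2
    rw [card_edgeSet_fromEdgeSet hsub, Nat.card_eq_fintype_card] at h2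
    omega

/-- The matrix tree theorem for graphs. -/
theorem tau_eq_det [CommRing R] [IsDomain R] (G : WGraph V R) (v : V) :
    G.tau = (G.lap + Matrix.single v v 1).det := by
  classical
  -- The extra 1 at (v, v) is the weight of declaring v a root; declaring any other vertex a root
  -- has weight 0.
  let w : V → Option V → R := fun x o => o.elim (if x = v then 1 else 0) fun y => G.wt x y
  have hM : G.lap + Matrix.single v v 1 =
      Matrix.of fun x y : V => (if x = y then ∑ o, w x o else 0) - w x (some y) := by
    ext x y
    simp only [Matrix.add_apply, lap_apply, Matrix.single_apply, Matrix.of_apply,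
      Fintype.sum_option, w, Option.elim_none, Option.elim_some, deg]
    by_cases h : x = y
    · subst h
      by_cases h : x = v
      · simp [h]; ring
      · simp [h, Ne.symm h]
    · have : ¬ (v = x ∧ v = y) := fun h' => h (h'.1.symm.trans h'.2)
      simp [h, this]
  rw [hM, det_eq_sum_isRootedForest]
  have hrest : ∑ f : V → Option V with IsRootedForest f, ∏ x, w x (f x)
      = ∑ f : V → Option V with (IsRootedForest f ∧ (∀ x, f x = none ↔ x = v) ∧
          ∀ x y, f x = some y → G.graph.Adj x y), ∏ x, w x (f x) := by
    symm
    refine Finset.sum_subset (fun f hf => ?_) (fun f hf hf' => ?_)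
    · simp only [Finset.mem_filter, Finset.mem_univ, true_and] at hf ⊢
      exact hf.1
    · simp only [Finset.mem_filter, Finset.mem_univ, true_and] at hf hf'
      by_contra hne
      have hw : ∀ x, w x (f x) ≠ 0 := fun x hx => hne (Finset.prod_eq_zero (Finset.mem_univ x) hx)
      have hroot : ∀ x, f x = none → x = v := by
        intro x hx
        by_contra hxv
        exact hw x (by simp [w, hx, hxv])
      have hadj : ∀ x y, f x = some y → G.graph.Adj x y := by
        intro x y hxy
        by_contra hn
        exact hw x (by simp [w, hxy, wt, hn])
      refine hf' ⟨hf, fun x => ⟨hroot x, ?_⟩, hadj⟩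
      rintro rfl
      -- A minimal element is a root, hence equals v.
      obtain ⟨z, -, hz⟩ := WellFounded.has_min hf Set.univ ⟨x, trivial⟩
      rcases hfz : f z with _ | y
      · exact hroot z hfz ▸ hfz
      · exact absurd hfz (hz y trivial)
  rw [hrest, tau]
  symm
  refine Finset.sum_bij (fun f _ => parentEdges f) ?_ ?_ ?_ ?_
  · intro f hf
    simp only [Finset.mem_filter, Finset.mem_univ, true_and] at hf
    exact parentEdges_mem_spanningTrees hf.1 hf.2.1 hf.2.2
  · intro f hf g hg h
    simp only [Finset.mem_filter, Finset.mem_univ, true_and] at hf hg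
    exact parentEdges_injective hf.1 hg.1 hf.2.1 hg.2.1 h
  · intro F hF
    obtain ⟨f, h1, h2, h3, h4⟩ := exists_parentEdges_eq hF v
    exact ⟨f, by simp only [Finset.mem_filter, Finset.mem_univ, true_and]; exact ⟨h1, h2, h3⟩, h4⟩
  · intro f hf
    simp only [Finset.mem_filter, Finset.mem_univ, true_and] at hf
    rw [hf.1.prod_parentEdges]
    refine Finset.prod_congr rfl fun x _ => ?_
    rcases hx : f x with _ | y
    · simp [w, (hf.2.1 x).1 hx]
    · simp [w, wt, hf.2.2 x y hx]

end WGraph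

/-! ### Rank one perturbations of the Laplacian. -/

namespace Matrix

variable {V R : Type*} [Fintype V] [DecidableEq V] [CommRing R]

/-- Adding a column vector times `bᵀ` to a matrix with zero column sums: only the sum of the entries
of the column vector matters. -/
theorem det_add_vecMulVec_of_sum_col (L : Matrix V V R) (hcol : ∀ y, ∑ x, L x y = 0) (a b : V → R)
    (v : V) : (L + vecMulVec a b).det = (∑ x, a x) * (L + vecMulVec (Pi.single v 1) b).det := by
  -- The columns of L + e_v bᵀ sum to b, so L + abᵀ = (1 + u1ᵀ)(L + e_v bᵀ), and det(1 + u1ᵀ) = 1 +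
  -- ∑u = ∑a.
  let u : V → R := a - Pi.single v 1
  have hu : (1 + replicateCol Unit u * replicateRow Unit (1 : V → R)).det = ∑ x, a x := by
    rw [det_one_add_replicateCol_mul_replicateRow]
    simp [u, dotProduct, Finset.sum_sub_distrib]
  rw [← hu, ← det_mul]
  congr 1
  ext x y
  have h1 : ∑ j, vecMulVec (Pi.single v (1 : R)) b j y = b y := by
    simp [vecMulVec_apply, ← Finset.sum_mul]
  have h2 : (replicateCol Unit u * replicateRow Unit (1 : V → R) *
      (L + vecMulVec (Pi.single v 1) b)) x y = u x * b y := by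
    simp only [mul_apply, replicateCol_apply, replicateRow_apply, Finset.univ_unique,
      Finset.sum_singleton, Pi.one_apply, mul_one, add_apply]
    rw [← Finset.mul_sum, Finset.sum_add_distrib, hcol, h1, zero_add]
  rw [add_mul, one_mul, add_apply (L + _), h2]
  simp only [add_apply, vecMulVec_apply, u, Pi.sub_apply]
  ring

end Matrix

/-- By symmetry of the Laplacian, a and b can be concentrated at v one after the other, via a
transpose. -/
theorem WGraph.det_lap_add_vecMulVec {V R : Type*} [Fintype V] [DecidableEq V] [CommRing R]
    [IsDomain R] [Nonempty V] (G : WGraph V R) (a b : V → R) :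
    (G.lap + Matrix.vecMulVec a b).det = (∑ x, a x) * (∑ x, b x) * G.tau := by
  obtain ⟨v⟩ := ‹Nonempty V›
  rw [G.lap.det_add_vecMulVec_of_sum_col G.sum_lap_col a b v, ← Matrix.det_transpose,
    Matrix.transpose_add, G.lap_transpose, Matrix.transpose_vecMulVec,
    G.lap.det_add_vecMulVec_of_sum_col G.sum_lap_col b _ v, G.tau_eq_det v,
    Matrix.single_eq_single_vecMulVec_single, mul_assoc]

/-! ### Block circulant determinants and folded sums. -/

section Circulant

variable {N : ℕ} [NeZero N] {K : Type*} [Field K] {θ : K}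

omit [NeZero N] in
theorem IsPrimitiveRoot.pow_fin_add (hθ : IsPrimitiveRoot θ N) (i j : Fin N) (t : ℕ) :
    θ ^ (((i + j : Fin N) : ℕ) * t) = θ ^ ((i : ℕ) * t) * θ ^ ((j : ℕ) * t) := by
  rw [pow_mul, Fin.val_add, ← pow_add, ← add_mul, pow_mul θ ((i : ℕ) + j)]
  congr 1
  exact (pow_eq_pow_mod _ hθ.pow_eq_one).symm

open scoped Kronecker in
/-- The determinant of a block circulant matrix. -/
theorem IsPrimitiveRoot.det_block_circulant {m : Type*} [Fintype m] [DecidableEq m]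
    (hθ : IsPrimitiveRoot θ N) (k : Fin N → Matrix m m K) :
    (Matrix.of fun p q : m × Fin N => k (q.2 - p.2) p.1 q.1).det =
      ∏ t : Fin N, (∑ d : Fin N, θ ^ ((d : ℕ) * t) • k d).det := by
  let W : Matrix (Fin N) (Fin N) K := Matrix.vandermonde fun i => θ ^ (i : ℕ)
  have hW : W.det ≠ 0 := Matrix.det_vandermonde_ne_zero_iff.2 fun i j h =>
    Fin.ext (hθ.pow_inj i.2 j.2 h)
  let F : Matrix (m × Fin N) (m × Fin N) K := (1 : Matrix m m K) ⊗ₖ W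
  have hF : F.det ≠ 0 := by
    rw [Matrix.det_kronecker]
    simp [hW]
  have hWa : ∀ i t : Fin N, W i t = θ ^ ((i : ℕ) * t) := fun i t =>
    (Matrix.vandermonde_apply _ _ _).trans (pow_mul _ _ _).symm
  -- The Fourier matrix intertwines the block circulant with the block diagonal of its transforms; F
  -- is invertible because the powers of θ are distinct.
  have key : (Matrix.of fun p q : m × Fin N => k (q.2 - p.2) p.1 q.1) * F =
      F * Matrix.blockDiagonal fun t : Fin N => ∑ d : Fin N, θ ^ ((d : ℕ) * t) • k d := by
    ext ⟨x, i⟩ ⟨y, t⟩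
    rw [Matrix.mul_apply, Matrix.mul_apply, Fintype.sum_prod_type, Fintype.sum_prod_type]
    simp only [Matrix.of_apply, F, Matrix.kronecker_apply, Matrix.one_apply, hWa,
      Matrix.blockDiagonal_apply, ite_mul, one_mul, zero_mul, mul_ite, mul_zero]
    simp only [Finset.sum_ite_eq', Finset.mem_univ, if_true]
    rw [Finset.sum_comm]
    simp only [Finset.sum_ite_eq, Finset.sum_ite_eq', Finset.mem_univ, if_true]
    rw [← Equiv.sum_comp (Equiv.addRight i)]
    simp only [Equiv.coe_addRight, add_sub_cancel_right, hθ.pow_fin_add]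
    rw [Matrix.sum_apply, Finset.mul_sum]
    refine Finset.sum_congr rfl fun d _ => ?_
    rw [Matrix.smul_apply, smul_eq_mul]
    ring
  have := congrArg Matrix.det key
  rw [Matrix.det_mul, Matrix.det_mul, mul_comm] at this
  rw [mul_left_cancel₀ hF this, Matrix.det_blockDiagonal]

/-- Sum over a period, with the indices `i` and `N - i` taken together. -/
theorem sum_range_eq_sum_half {M : Type*} [AddCommMonoid M] {N : ℕ} (hN : 0 < N) (f : ℕ → M) :
    ∑ i ∈ Finset.range N, f i =
      f 0 + ∑ i ∈ Finset.Icc 1 (N / 2), (if 2 * i = N then f i else f i + f (N - i)) := by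
  have h1 : ∀ i, (if 2 * i = N then f i else f i + f (N - i)) =
      f i + if 2 * i ≠ N then f (N - i) else 0 := by
    intro i
    by_cases h : 2 * i = N <;> simp [h]
  have h2 : ∑ i ∈ Finset.Icc 1 (N / 2), (if 2 * i ≠ N then f (N - i) else 0) =
      ∑ i ∈ Finset.Ioc (N / 2) (N - 1), f i := by
    rw [← Finset.sum_filter]
    refine Finset.sum_bij' (fun i _ => N - i) (fun i _ => N - i) ?_ ?_ ?_ ?_ ?_ <;>
      intro i hi <;> simp only [Finset.mem_filter, Finset.mem_Icc, Finset.mem_Ioc] at * <;> omega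
  rw [Finset.sum_congr rfl fun i _ => h1 i, Finset.sum_add_distrib, h2]
  have h3 : Finset.range N = insert 0 (Finset.Icc 1 (N / 2) ∪ Finset.Ioc (N / 2) (N - 1)) := by
    ext i
    simp only [Finset.mem_range, Finset.mem_insert, Finset.mem_union, Finset.mem_Icc,
      Finset.mem_Ioc]
    omega
  rw [h3, Finset.sum_insert (by simp), Finset.sum_union]
  rw [Finset.disjoint_left]
  intro i hi
  simp only [Finset.mem_Icc, Finset.mem_Ioc] at *
  omega

end Circulant

/-! ### Invertibility of L_S. -/

section FixedPart

variable {V : Type*} [Fintype V] [DecidableEq V]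

omit [Fintype V] [DecidableEq V] in
theorem WGraph.wt_pos {G : WGraph V ℝ} (hpos : ∀ e ∈ G.graph.edgeSet, 0 < G.weight e) {u v : V}
    (h : G.graph.Adj u v) : 0 < G.wt u v := by
  rw [WGraph.wt, if_pos h]
  exact hpos _ h

omit [Fintype V] [DecidableEq V] in
theorem WGraph.wt_nonneg {G : WGraph V ℝ} (hpos : ∀ e ∈ G.graph.edgeSet, 0 < G.weight e)
    (u v : V) : 0 ≤ G.wt u v := by
  by_cases h : G.graph.Adj u v
  · exact (WGraph.wt_pos hpos h).le
  · rw [WGraph.wt, if_neg h]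

/-- The determinant is a sum of nonnegative forest weights, in which being a root costs the total
weight of the edges leaving S. Shortest paths to h ∉ S, cut where they leave S, give a forest of
positive weight. -/
theorem lapS_det_pos {G : WGraph V ℝ} (hconn : G.graph.Connected)
    (hpos : ∀ e ∈ G.graph.edgeSet, 0 < G.weight e) (σ : Equiv.Perm V) {h : V} (hh : σ h ≠ h) :
    0 < (lapS G σ).det := by
  classical
  let w : FixedVertex σ → Option (FixedVertex σ) → ℝ := fun x o =>
    o.elim (∑ y : {y : V // ¬ σ y = y}, G.wt x y) fun y => G.wt x y
  have hM : lapS G σ = Matrix.of fun x y : FixedVertex σ =>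
      (if x = y then ∑ o, w x o else 0) - w x (some y) := by
    ext x y
    simp only [lapS, Matrix.submatrix_apply, WGraph.lap_apply, Matrix.of_apply,
      Fintype.sum_option, w, Option.elim_none, Option.elim_some, Subtype.ext_iff, WGraph.deg]
    rw [add_comm (∑ y : {y : V // ¬ σ y = y}, G.wt x y)]
    rw [← Fintype.sum_subtype_add_sum_subtype (fun v => σ v = v) (fun u => G.wt x u)]
  have hw : ∀ x o, 0 ≤ w x o := by
    rintro x (_ | y)
    · exact Finset.sum_nonneg fun y _ => G.wt_nonneg hpos x y
    · exact G.wt_nonneg hpos x y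
  rw [hM, det_eq_sum_isRootedForest]
  refine Finset.sum_pos' (fun f _ => Finset.prod_nonneg fun x _ => hw _ _) ?_
  obtain ⟨p, hpv, hp⟩ := hconn.exists_parent h
  have hx : ∀ x : FixedVertex σ, ∃ y, p x = some y := fun x =>
    Option.ne_none_iff_exists'.1 fun hn => hh ((hpv x).1 hn ▸ x.2)
  choose q hq using hx
  let f : FixedVertex σ → Option (FixedVertex σ) := fun x =>
    if hy : σ (q x) = q x then some ⟨q x, hy⟩ else none
  refine ⟨f, ?_, Finset.prod_pos fun x _ => ?_⟩
  · rw [Finset.mem_filter]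
    refine ⟨Finset.mem_univ _, .of_rank (fun x => G.graph.dist x h) fun x y hxy => ?_⟩
    by_cases hy : σ (q x) = q x
    · simp only [f, dif_pos hy] at hxy
      obtain rfl := Option.some.inj hxy
      exact (hp _ _ (hq x)).2
    · simp [f, dif_neg hy] at hxy
  · have hadj := WGraph.wt_pos hpos (hp _ _ (hq x)).1
    by_cases hy : σ (q x) = q x
    · simpa only [f, dif_pos hy, w, Option.elim_some] using hadj
    · simp only [f, dif_neg hy, w, Option.elim_none]
      exact Finset.sum_pos' (fun y _ => G.wt_nonneg hpos x y) ⟨⟨q x, hy⟩, Finset.mem_univ _, hadj⟩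

end FixedPart

theorem Finset.sum_ite_eq_zero_else {ι M : Type*} [Fintype ι] [DecidableEq ι] [AddCommGroup M]
    (x : ι) (g : ι → M) : ∑ y, (if x = y then 0 else g y) = ∑ y, g y - g x := by
  have h : ∀ y, (if x = y then 0 else g y) = g y - if x = y then g y else 0 := by
    intro y
    split_ifs <;> simp
  rw [Finset.sum_congr rfl fun y _ => h y, Finset.sum_sub_distrib, Finset.sum_ite_eq,
    if_pos (Finset.mem_univ x)]

/-! ### Orbits of σ and the block structure. -/

section PeriodicGraph

variable {V : Type*} [Fintype V] [DecidableEq V] {G : WGraph V ℝ} {N : ℕ} {σ : Equiv.Perm V}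
  {H₀ : Finset V}

omit [Fintype V] [DecidableEq V] in
theorem IsOneNPeriodic.pow_order (hσ : IsOneNPeriodic G N σ) : σ ^ N = 1 :=
  hσ.order ▸ pow_orderOf_eq_one σ

omit [Fintype V] [DecidableEq V] in
theorem IsOneNPeriodic.wt_pow (hσ : IsOneNPeriodic G N σ) (i : ℕ) (u v : V) :
    G.wt ((σ ^ i) u) ((σ ^ i) v) = G.wt u v := by
  induction i with
  | zero => rfl
  | succ i ih => rw [pow_succ', Equiv.Perm.mul_apply, Equiv.Perm.mul_apply, hσ.map_wt, ih]

theorem IsOneNPeriodic.lap_pow (hσ : IsOneNPeriodic G N σ) (i : ℕ) (u v : V) :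
    G.lap ((σ ^ i) u) ((σ ^ i) v) = G.lap u v := by
  have hdeg : G.deg ((σ ^ i) u) = G.deg u := by
    rw [WGraph.deg, ← Equiv.sum_comp (σ ^ i)]
    exact Finset.sum_congr rfl fun v _ => hσ.wt_pow i u v
  rw [G.lap_apply, G.lap_apply, hσ.wt_pow, hdeg]
  simp only [EmbeddingLike.apply_eq_iff_eq]

omit [Fintype V] [DecidableEq V] in
theorem FixedVertex.pow_apply (s : FixedVertex σ) (i : ℕ) : (σ ^ i) s = s :=
  Function.IsFixedPt.perm_pow s.2 i

omit [Fintype V] [DecidableEq V] in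
theorem IsOneNPeriodic.wt_fixed (hσ : IsOneNPeriodic G N σ) (s : FixedVertex σ) (i : ℕ) (v : V) :
    G.wt s ((σ ^ i) v) = G.wt s v := by
  conv_lhs => rw [← s.pow_apply i]
  exact hσ.wt_pow i s v

omit [Fintype V] [DecidableEq V] in
-- Apply σ^(N−i) to the edge from y to σ^i x. This unfolds the sums over i ≤ N/2 into sums over a
-- full period.
theorem IsOneNPeriodic.matR_swap (hσ : IsOneNPeriodic G N σ) {i : ℕ} (hi : i ≤ N) (x y : H₀) :
    matR G σ H₀ i y x = G.wt x ((σ ^ (N - i)) y) := by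
  rw [matR, Matrix.of_apply, ← hσ.wt_pow (N - i), ← Equiv.Perm.mul_apply, ← pow_add,
    Nat.sub_add_cancel hi, hσ.pow_order, G.wt_comm]
  rfl

theorem IsBasePart.pow_ne (hH₀ : IsBasePart N σ H₀) {i : ℕ} (hi : i < N) (x : H₀) :
    σ ((σ ^ i) x) ≠ (σ ^ i) x := by
  have : (σ ^ i) (x : V) ∈ (Finset.range N).biUnion (copy σ H₀) :=
    Finset.mem_biUnion.2 ⟨i, Finset.mem_range.2 hi, Finset.mem_map.2 ⟨x, x.2, rfl⟩⟩
  rw [hH₀.cover] at this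
  exact (Finset.mem_filter.1 this).2

theorem IsBasePart.pow_injective (hH₀ : IsBasePart N σ H₀) {i j : ℕ} (hi : i < N) (hj : j < N)
    {x y : H₀} (h : (σ ^ i) (x : V) = (σ ^ j) (y : V)) : i = j ∧ x = y := by
  have hij : i = j := by
    by_contra hne
    refine Finset.disjoint_left.1 (hH₀.disjoint i hi j hj hne)
      (Finset.mem_map.2 ⟨x, x.2, rfl⟩) (Finset.mem_map.2 ⟨y, y.2, h.symm⟩)
  subst hij
  exact ⟨rfl, Subtype.ext ((σ ^ i).injective h)⟩

/-- The decomposition of the vertex set into the fixed vertices and the copies of `H₀`. -/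
noncomputable def IsBasePart.equiv (hH₀ : IsBasePart N σ H₀) :
    FixedVertex σ ⊕ (H₀ × Fin N) ≃ V :=
  Equiv.ofBijective (Sum.elim Subtype.val fun p => (σ ^ (p.2 : ℕ)) p.1) (by
    constructor
    · rintro (s | ⟨x, i⟩) (s' | ⟨y, j⟩) h
      · exact congrArg _ (Subtype.ext h)
      · have h : (s : V) = (σ ^ (j : ℕ)) y := h
        exact absurd (h ▸ s.2) (hH₀.pow_ne j.2 y)
      · have h : (σ ^ (i : ℕ)) (x : V) = s' := h
        exact absurd (h.symm ▸ s'.2) (hH₀.pow_ne i.2 x)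
      · obtain ⟨hij, hxy⟩ := hH₀.pow_injective i.2 j.2 h
        exact congrArg _ (Prod.ext hxy (Fin.ext hij))
    · intro v
      by_cases hv : σ v = v
      · exact ⟨Sum.inl ⟨v, hv⟩, rfl⟩
      · have : v ∈ (Finset.range N).biUnion (copy σ H₀) := by
          rw [hH₀.cover]
          exact Finset.mem_filter.2 ⟨Finset.mem_univ _, hv⟩
        obtain ⟨i, hi, hm⟩ := Finset.mem_biUnion.1 this
        obtain ⟨x, hx, rfl⟩ := Finset.mem_map.1 hm
        exact ⟨Sum.inr (⟨x, hx⟩, ⟨i, Finset.mem_range.1 hi⟩), rfl⟩)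

@[simp]
theorem IsBasePart.equiv_inl (hH₀ : IsBasePart N σ H₀) (s : FixedVertex σ) :
    hH₀.equiv (Sum.inl s) = s := rfl

@[simp]
theorem IsBasePart.equiv_inr (hH₀ : IsBasePart N σ H₀) (p : H₀ × Fin N) :
    hH₀.equiv (Sum.inr p) = (σ ^ (p.2 : ℕ)) p.1 := rfl

theorem IsBasePart.sum_eq {M : Type*} [AddCommMonoid M] (hH₀ : IsBasePart N σ H₀) (g : V → M) :
    ∑ v, g v = ∑ s : FixedVertex σ, g s + ∑ x : H₀, ∑ i ∈ Finset.range N, g ((σ ^ i) x) := by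
  rw [← hH₀.equiv.sum_comp, Fintype.sum_sum_type, Fintype.sum_prod_type]
  congr 1
  refine Finset.sum_congr rfl fun x _ => ?_
  exact Fin.sum_univ_eq_sum_range (fun i => g ((σ ^ i) x)) N

theorem IsBasePart.lap_apply (hH₀ : IsBasePart N σ H₀) {i : ℕ} (hi : i < N) (x y : H₀) :
    G.lap x ((σ ^ i) y) = (if i = 0 then if x = y then G.deg x else 0 else 0)
      - G.wt x ((σ ^ i) y) := by
  rw [G.lap_apply, ← ite_and]
  congr 1
  refine if_congr ⟨fun h => ?_, ?_⟩ rfl rfl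
  · obtain ⟨h1, h2⟩ := hH₀.pow_injective (i := 0) (x := x) (by omega) hi h
    exact ⟨h1.symm, h2⟩
  · rintro ⟨rfl, rfl⟩
    rfl

/-! ### The digraphs D_t and the twisted Laplacian. -/

section Twisted

variable {θ : ℂ}

theorem IsPrimitiveRoot.pow_sub_mul (hθ : IsPrimitiveRoot θ N) {i : ℕ} (hi : i ≤ N) (t : ℕ) :
    θ ^ ((N - i) * t) = (θ ^ (i * t))⁻¹ := by
  refine eq_inv_of_mul_eq_one_left ?_
  rw [← pow_add, ← add_mul, Nat.sub_add_cancel hi, pow_mul, hθ.pow_eq_one, one_pow]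

omit [DecidableEq V] [Fintype V] in
theorem IsOneNPeriodic.arcWeight_eq (hσ : IsOneNPeriodic G N σ) (hN : 0 < N)
    (hθ : IsPrimitiveRoot θ N) (t : ℕ) (x y : H₀) :
    arcWeight G N σ H₀ θ t x y =
      ∑ i ∈ Finset.range N, θ ^ (i * t) * (G.wt x ((σ ^ i) y) : ℂ) := by
  rw [sum_range_eq_sum_half hN, arcWeight]
  congr 1
  · simp
  · refine Finset.sum_congr rfl fun i hi => ?_
    have hi : i ≤ N := by have := Finset.mem_Icc.1 hi; omega
    rw [hσ.matR_swap hi x y, hθ.pow_sub_mul hi, matR, Matrix.of_apply]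

omit [DecidableEq V] [Fintype V] in
theorem IsOneNPeriodic.sum_half_eq (hσ : IsOneNPeriodic G N σ) (hN : 0 < N)
    (hθ : IsPrimitiveRoot θ N) (t : ℕ) (x y : H₀) :
    ∑ i ∈ Finset.Icc 1 (N / 2),
      (if 2 * i = N then (1 - θ ^ (i * t)) * (matR G σ H₀ i x y : ℂ)
        else (1 - θ ^ (i * t)) * (matR G σ H₀ i x y : ℂ)
          + (1 - (θ ^ (i * t))⁻¹) * (matR G σ H₀ i y x : ℂ)) =
      ∑ i ∈ Finset.range N, (1 - θ ^ (i * t)) * (G.wt x ((σ ^ i) y) : ℂ) := by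
  rw [sum_range_eq_sum_half hN]
  simp only [zero_mul, pow_zero, sub_self, zero_add]
  refine Finset.sum_congr rfl fun i hi => ?_
  have hi : i ≤ N := by have := Finset.mem_Icc.1 hi; omega
  rw [hσ.matR_swap hi x y, hθ.pow_sub_mul hi, matR, Matrix.of_apply]

/-- The arcs to u make up for the twist by θ: each edge contributes 1 − θ^{it} to u and θ^{it}
inside H₀, so the total is the untwisted degree. -/
theorem IsOneNPeriodic.rootWeight_eq (hσ : IsOneNPeriodic G N σ) (hN : 0 < N)
    (hH₀ : IsBasePart N σ H₀) (hθ : IsPrimitiveRoot θ N) (t : ℕ) (x : H₀) :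
    rootWeight G N σ H₀ θ t x = G.deg x - ∑ y, arcWeight G N σ H₀ θ t x y := by
  have hdiag : ∑ i ∈ Finset.Icc 1 (N / 2),
      (if 2 * i = N then (1 - θ ^ (i * t)) * (matR G σ H₀ i x x : ℂ)
        else (2 - θ ^ (i * t) - (θ ^ (i * t))⁻¹) * (matR G σ H₀ i x x : ℂ)) =
      ∑ i ∈ Finset.range N, (1 - θ ^ (i * t)) * (G.wt x ((σ ^ i) x) : ℂ) := by
    rw [← hσ.sum_half_eq hN hθ]
    refine Finset.sum_congr rfl fun i _ => ?_
    split_ifs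
    · rfl
    · ring
  rw [rootWeight, Finset.sum_comm, Finset.sum_congr rfl fun y _ => hσ.sum_half_eq hN hθ t x y,
    hdiag, Finset.filter_ne', Finset.sum_erase_add _ _ (Finset.mem_univ x), WGraph.deg,
    hH₀.sum_eq, Complex.ofReal_add]
  simp only [Complex.ofReal_sum, hσ.arcWeight_eq hN hθ, sub_mul, one_mul, Finset.sum_sub_distrib]
  ring

omit [DecidableEq V] [Fintype V] in
theorem wt_eq_zero {u v : V} (h : ¬ G.graph.Adj u v) : G.wt u v = 0 := if_neg h

/-- Where D_t has no arc between distinct vertices, every summand of the weight vanishes; only loops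
have to be discarded. -/
theorem rootedDigraph_arc_some (t : ℕ) (x y : H₀) :
    (rootedDigraph G N σ H₀ θ t).arc x (some y) =
      if x = y then 0 else arcWeight G N σ H₀ θ t x y := by
  by_cases hxy : x = y
  · subst hxy
    rw [if_pos rfl]
    refine if_neg ?_
    rintro (h | h)
    · exact G.graph.loopless.irrefl _ h
    · exact h.1 rfl
  rw [if_neg hxy, WDigraph.arc]
  split_ifs with h
  · rfl
  · have h : ¬ (G.graph.Adj x y ∨ (x ≠ y ∧ ∃ i ∈ Finset.Icc 1 (N / 2),
            G.graph.Adj x ((σ ^ i) y) ∨ (2 * i ≠ N ∧ G.graph.Adj y ((σ ^ i) x)))) := h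
    push Not at h
    rw [arcWeight, wt_eq_zero h.1, Finset.sum_eq_zero, Complex.ofReal_zero, zero_add]
    intro i hi
    obtain ⟨h1, h2⟩ := h.2 hxy i hi
    have h1 : matR G σ H₀ i x y = 0 := wt_eq_zero h1
    split_ifs with hiN
    · simp [h1]
    · have h2 : matR G σ H₀ i y x = 0 := wt_eq_zero (h2 hiN)
      simp [h1, h2]

theorem rootedDigraph_arc_none (t : ℕ) (x : H₀) :
    (rootedDigraph G N σ H₀ θ t).arc x none = rootWeight G N σ H₀ θ t x := by
  rw [WDigraph.arc]
  split_ifs with h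
  · rfl
  · have h : ¬ ((∃ i ∈ Finset.Icc 1 (N / 2), ∃ y : H₀,
            G.graph.Adj x ((σ ^ i) y) ∨ (2 * i ≠ N ∧ G.graph.Adj y ((σ ^ i) x))) ∨
            InNbhdS G σ x) := h
    push Not at h
    obtain ⟨h1, h2⟩ := h
    have hR : ∀ i ∈ Finset.Icc 1 (N / 2), ∀ y : H₀, matR G σ H₀ i x y = 0 ∧
        (2 * i ≠ N → matR G σ H₀ i y x = 0) := fun i hi y =>
      ⟨wt_eq_zero (h1 i hi y).1, fun hiN => wt_eq_zero ((h1 i hi y).2 hiN)⟩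
    have hS : ∀ s : FixedVertex σ, G.wt x s = 0 := fun s => wt_eq_zero fun hs =>
      h2 ⟨s, s.2, hs.symm⟩
    rw [rootWeight, Finset.sum_eq_zero, Finset.sum_eq_zero, Finset.sum_eq_zero]
    · simp
    · intro s _
      simp [hS]
    · intro i hi
      simp [(hR i hi x).1]
    · intro i hi
      refine Finset.sum_eq_zero fun y _ => ?_
      split_ifs with hiN
      · simp [(hR i hi y).1]
      · simp [(hR i hi y).1, (hR i hi y).2 hiN]

/-- The loops missing from D_t do no harm: the loop weight would enter both the out-degree and the
diagonal adjacency entry, and cancel. -/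
theorem IsOneNPeriodic.tau_rootedDigraph (hσ : IsOneNPeriodic G N σ) (hN : 0 < N)
    (hH₀ : IsBasePart N σ H₀) (hθ : IsPrimitiveRoot θ N) (t : ℕ) :
    (rootedDigraph G N σ H₀ θ t).tau none =
      (∑ d : Fin N, θ ^ ((d : ℕ) * t) •
        Matrix.of fun x y : H₀ => (G.lap x ((σ ^ (d : ℕ)) y) : ℂ)).det := by
  rw [WDigraph.tau_none_eq_det]
  congr 1
  ext x y
  have h1 : ∑ o, (rootedDigraph G N σ H₀ θ t).arc x o = G.deg x - arcWeight G N σ H₀ θ t x x := by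
    rw [Fintype.sum_option, rootedDigraph_arc_none, hσ.rootWeight_eq hN hH₀ hθ]
    simp only [rootedDigraph_arc_some]
    rw [Finset.sum_ite_eq_zero_else]
    ring
  rw [Matrix.of_apply, h1, rootedDigraph_arc_some, Matrix.sum_apply]
  simp only [Matrix.smul_apply, Matrix.of_apply, smul_eq_mul]
  rw [Fin.sum_univ_eq_sum_range (fun d => θ ^ (d * t) * (G.lap x ((σ ^ d) y) : ℂ)) N]
  have h2 : ∑ d ∈ Finset.range N, θ ^ (d * t) * (G.lap x ((σ ^ d) y) : ℂ) =
      (if x = y then (G.deg x : ℂ) else 0) - arcWeight G N σ H₀ θ t x y := by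
    rw [hσ.arcWeight_eq hN hθ]
    have : ∀ d ∈ Finset.range N, θ ^ (d * t) * (G.lap x ((σ ^ d) y) : ℂ) =
        (if d = 0 then if x = y then (G.deg x : ℂ) else 0 else 0)
          - θ ^ (d * t) * (G.wt x ((σ ^ d) y) : ℂ) := by
      intro d hd
      rw [hH₀.lap_apply (Finset.mem_range.1 hd)]
      by_cases h0 : d = 0
      · subst h0
        split_ifs <;> simp
      · simp [h0]
    rw [Finset.sum_congr rfl this, Finset.sum_sub_distrib, Finset.sum_ite_eq',
      if_pos (Finset.mem_range.2 hN)]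
  rw [h2]
  by_cases hxy : x = y
  · subst hxy
    simp
  · simp [hxy]

end Twisted

/-! ### The Laplacian of H₀*. -/

section Star

omit [DecidableEq V] [Fintype V] in
theorem matB_eq_zero {y : H₀} (h : ¬ InNbhdS G σ y) (s : FixedVertex σ) : matB G σ H₀ s y = 0 :=
  if_neg fun hs => h ⟨s, s.2, hs⟩

theorem schurB_eq_zero {x y : H₀} (h : ¬ (InNbhdS G σ x ∧ InNbhdS G σ y)) :
    schurB G σ H₀ x y = 0 := by
  have key : ∀ {x y : H₀}, ¬ InNbhdS G σ y → schurB G σ H₀ x y = 0 := by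
    intro x y hy
    rw [schurB, Matrix.mul_apply]
    exact Finset.sum_eq_zero fun s _ => by rw [matB_eq_zero hy, mul_zero]
  rcases not_and_or.1 h with h | h
  · rw [schurB_comm]
    exact key h
  · exact key h

theorem IsOneNPeriodic.starWeight_eq (hσ : IsOneNPeriodic G N σ) (hN : 0 < N) (x y : H₀) :
    starWeight G N σ H₀ x y =
      ∑ i ∈ Finset.range N, G.wt x ((σ ^ i) y) + N * schurB G σ H₀ x y := by
  rw [sum_range_eq_sum_half hN, starWeight]
  congr 1
  · congr 1
    refine Finset.sum_congr rfl fun i hi => ?_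
    have hi : i ≤ N := by have := Finset.mem_Icc.1 hi; omega
    rw [hσ.matR_swap hi x y, matR, Matrix.of_apply]
    split_ifs with hiN
    -- At i = N/2 the two halved weights are equal and add up to one full term.
    · rw [show N - i = i by omega]
      ring
    · rfl
  · split_ifs with h
    · rfl
    · rw [schurB_eq_zero h, mul_zero]

theorem starGraph_wt (x y : H₀) :
    (starGraph G N σ H₀).wt x y = if x = y then 0 else starWeight G N σ H₀ x y := by
  by_cases hxy : x = y
  · subst hxy
    rw [if_pos rfl, WGraph.wt_self]
  rw [if_neg hxy, WGraph.wt]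
  split_ifs with h
  · rfl
  · have h : ¬ (x ≠ y ∧ ((G.graph.Adj x y ∨
        (∃ i ∈ Finset.Icc 1 (N / 2), G.graph.Adj x ((σ ^ i) y)) ∨
        (InNbhdS G σ x ∧ InNbhdS G σ y)) ∨ (G.graph.Adj y x ∨
        (∃ i ∈ Finset.Icc 1 (N / 2), G.graph.Adj y ((σ ^ i) x)) ∨
        (InNbhdS G σ y ∧ InNbhdS G σ x)))) := h
    rw [not_and] at h
    have h := h hxy
    rw [not_or, not_or, not_or, not_or, not_or] at h
    obtain ⟨⟨h1, h2, h3⟩, -, h4, -⟩ := h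
    rw [starWeight, wt_eq_zero h1, if_neg h3, Finset.sum_eq_zero]
    · simp
    · intro i hi
      have h5 : matR G σ H₀ i x y = 0 := wt_eq_zero fun h => h2 ⟨i, hi, h⟩
      have h6 : matR G σ H₀ i y x = 0 := wt_eq_zero fun h => h4 ⟨i, hi, h⟩
      simp [h5, h6]

/-- The rows of L(G) indexed by S sum to zero, so L_S 1 = N B 1; multiply by BᵀL_S⁻¹. -/
theorem IsOneNPeriodic.sum_schurB (hσ : IsOneNPeriodic G N σ) (hH₀ : IsBasePart N σ H₀)
    (hL : IsUnit (lapS G σ).det) (x : H₀) :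
    N * ∑ y, schurB G σ H₀ x y = ∑ s : FixedVertex σ, G.wt x s := by
  have hrow : (N : ℝ) • matB G σ H₀ *ᵥ 1 = lapS G σ *ᵥ 1 := by
    ext s
    have h := G.sum_lap_row s
    rw [hH₀.sum_eq] at h
    have h2 : ∀ y : H₀, ∑ i ∈ Finset.range N, G.lap s ((σ ^ i) y) = -(N * G.wt s y) := by
      intro y
      have : ∀ i ∈ Finset.range N, G.lap s ((σ ^ i) y) = - G.wt s y := by
        intro i hi
        have hne : (s : V) ≠ (σ ^ i) y := fun h =>
          hH₀.pow_ne (Finset.mem_range.1 hi) y (h ▸ s.2)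
        rw [G.lap_apply, if_neg hne, hσ.wt_fixed, zero_sub]
      rw [Finset.sum_congr rfl this, Finset.sum_const, Finset.card_range]
      simp
    rw [Finset.sum_congr rfl fun y _ => h2 y, Finset.sum_neg_distrib, ← sub_eq_add_neg,
      sub_eq_zero, ← Finset.mul_sum] at h
    simp only [Matrix.mulVec, dotProduct, Pi.smul_apply, Pi.one_apply, mul_one, smul_eq_mul,
      lapS, matB, Matrix.submatrix_apply, Matrix.of_apply]
    exact h.symm
  have h := congrArg (fun v => ((matB G σ H₀)ᵀ * (lapS G σ)⁻¹) *ᵥ v) hrow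
  simp only [Matrix.mulVec_mulVec, Matrix.mul_assoc, Matrix.nonsing_inv_mul _ hL,
    Matrix.mul_one, Matrix.mulVec_smul] at h
  have h := congrFun h x
  simp only [Matrix.mulVec, dotProduct, Pi.smul_apply, Pi.one_apply, mul_one, smul_eq_mul,
    Matrix.transpose_apply] at h
  rw [schurB, Matrix.mul_assoc, h]
  exact Finset.sum_congr rfl fun s _ => G.wt_comm _ _

/-- By `sum_schurB` the edges of weight N(BᵀL_S⁻¹B) replace exactly the degree lost to S. The
diagonal value of `starWeight` cancels like a loop. -/
theorem IsOneNPeriodic.lap_starGraph (hσ : IsOneNPeriodic G N σ) (hN : 0 < N)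
    (hH₀ : IsBasePart N σ H₀) (hL : IsUnit (lapS G σ).det) (x y : H₀) :
    (starGraph G N σ H₀).lap x y =
      ∑ d ∈ Finset.range N, G.lap x ((σ ^ d) y) - N * schurB G σ H₀ x y := by
  have h1 : ∑ d ∈ Finset.range N, G.lap x ((σ ^ d) y) =
      (if x = y then G.deg x else 0) - ∑ d ∈ Finset.range N, G.wt x ((σ ^ d) y) := by
    rw [Finset.sum_congr rfl fun d hd => hH₀.lap_apply (Finset.mem_range.1 hd) x y,
      Finset.sum_sub_distrib, Finset.sum_ite_eq', if_pos (Finset.mem_range.2 hN)]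
  have h2 : (starGraph G N σ H₀).deg x = G.deg x - starWeight G N σ H₀ x x := by
    have h3 : G.deg x = ∑ y, starWeight G N σ H₀ x y := by
      simp only [hσ.starWeight_eq hN]
      rw [Finset.sum_add_distrib, ← Finset.mul_sum, hσ.sum_schurB hH₀ hL, WGraph.deg, hH₀.sum_eq,
        add_comm]
    rw [h3, WGraph.deg, ← Finset.sum_ite_eq_zero_else]
    exact Finset.sum_congr rfl fun y _ => starGraph_wt x y
  rw [WGraph.lap_apply, h1, h2, starGraph_wt, hσ.starWeight_eq hN, hσ.starWeight_eq hN]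
  by_cases hxy : x = y
  · subst hxy
    simp only [if_true]
    ring
  · simp only [hxy, if_false]
    ring

end Star

/-! ### Elimination of S. -/

/-- The blocks of the block circulant Schur complement of `L_S` in the Laplacian matrix of `G` plus
the rank one matrix that is `1` on pairs of vertices outside `S`. -/
noncomputable def circulantBlock (G : WGraph V ℝ) (σ : Equiv.Perm V) (H₀ : Finset V) (d : ℕ) :
    Matrix H₀ H₀ ℝ :=
  Matrix.of fun x y => G.lap x ((σ ^ d) y) + 1 - schurB G σ H₀ x y

theorem IsOneNPeriodic.lap_sub [NeZero N] (hσ : IsOneNPeriodic G N σ) (i j : Fin N) (x y : V) :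
    G.lap ((σ ^ (i : ℕ)) x) ((σ ^ (j : ℕ)) y) = G.lap x ((σ ^ ((j - i : Fin N) : ℕ)) y) := by
  rw [← hσ.lap_pow i x, ← Equiv.Perm.mul_apply, ← pow_add]
  congr 2
  have h : (((i + (j - i) : Fin N) : ℕ)) = j := by rw [add_sub_cancel]
  rw [Fin.val_add] at h
  rw [← h]
  exact (pow_eq_pow_mod _ hσ.pow_order).symm

theorem IsOneNPeriodic.det_schur [NeZero N] [Nonempty V] (hσ : IsOneNPeriodic G N σ) (hH₀ : IsBasePart N σ H₀)
    (hL : IsUnit (lapS G σ).det) :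
    ((Fintype.card H₀ * N) ^ 2 * G.tau : ℝ) = (lapS G σ).det *
      (Matrix.of fun p q : H₀ × Fin N =>
        circulantBlock G σ H₀ ((q.2 - p.2 : Fin N) : ℕ) p.1 q.1).det := by
  -- Vanishing on S, this vector changes only the block outside S, where it adds 1 to every entry.
  let a : V → ℝ := fun v => if σ v = v then 0 else 1
  have ha : ∑ v, a v = Fintype.card H₀ * N := by
    rw [hH₀.sum_eq, Finset.sum_eq_zero, zero_add]
    · have : ∀ x : H₀, ∑ i ∈ Finset.range N, a ((σ ^ i) x) = N := by
        intro x
        rw [Finset.sum_congr rfl fun i hi => if_neg (hH₀.pow_ne (Finset.mem_range.1 hi) x)]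
        simp
      rw [Finset.sum_congr rfl fun x _ => this x]
      simp
    · exact fun s _ => if_pos s.2
  have h := G.det_lap_add_vecMulVec a a
  rw [ha, ← pow_two, ← Matrix.det_submatrix_equiv_self hH₀.equiv] at h
  rw [← h]
  let C : Matrix (FixedVertex σ) (H₀ × Fin N) ℝ := (-matB G σ H₀).submatrix id Prod.fst
  have hblock : (G.lap + Matrix.vecMulVec a a).submatrix hH₀.equiv hH₀.equiv =
      Matrix.fromBlocks (lapS G σ) C Cᵀ (Matrix.of fun p q : H₀ × Fin N =>
        G.lap p.1 ((σ ^ ((q.2 - p.2 : Fin N) : ℕ)) q.1) + 1) := by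
    have hC : ∀ (s : FixedVertex σ) (x : H₀) (i : Fin N),
        G.lap s ((σ ^ (i : ℕ)) x) = - G.wt s x := by
      intro s x i
      have hne : (s : V) ≠ (σ ^ (i : ℕ)) x := fun h => hH₀.pow_ne i.2 x (h ▸ s.2)
      rw [G.lap_apply, if_neg hne, hσ.wt_fixed, zero_sub]
    ext (s | ⟨x, i⟩) (s' | ⟨y, j⟩)
    · simp [Matrix.vecMulVec_apply, a, s.2, lapS]
    · simp [Matrix.vecMulVec_apply, a, s.2, hC, C, matB]
    · have := congrFun (congrFun G.lap_transpose ((σ ^ (i : ℕ)) x)) s'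
      rw [Matrix.transpose_apply] at this
      simp [Matrix.vecMulVec_apply, a, s'.2, ← this, hC, C, matB]
    · simp [Matrix.vecMulVec_apply, a, hH₀.pow_ne i.2 x, hH₀.pow_ne j.2 y, hσ.lap_sub]
  let _ := Matrix.invertibleOfIsUnitDet _ hL
  rw [hblock, Matrix.det_fromBlocks₁₁, Matrix.invOf_eq_nonsing_inv]
  congr 2
  have hs : Cᵀ * (lapS G σ)⁻¹ * C = (schurB G σ H₀).submatrix Prod.fst Prod.fst := by
    ext p q
    simp [C, schurB, Matrix.mul_apply]
  rw [hs]
  rfl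

end PeriodicGraph

/-! ### The Fourier factors and the final formula. -/

section FourierBlocks

variable {V : Type*} [Fintype V] [DecidableEq V] {G : WGraph V ℝ} {N : ℕ} {σ : Equiv.Perm V}
  {H₀ : Finset V} {θ : ℂ}

/-- At t = 0 the blocks add up to L(H₀*) + NJ, a rank one perturbation with ∑a = Nm and ∑b = m. -/
theorem IsOneNPeriodic.det_sum_circulantBlock_zero (hσ : IsOneNPeriodic G N σ) (hN : 0 < N)
    (hH₀ : IsBasePart N σ H₀) (hL : IsUnit (lapS G σ).det) [Nonempty H₀] :
    (∑ d : Fin N, θ ^ ((d : ℕ) * 0) • (circulantBlock G σ H₀ d).map ((↑) : ℝ → ℂ)).det =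
      ((N * Fintype.card H₀ ^ 2 * (starGraph G N σ H₀).tau : ℝ) : ℂ) := by
  have h : (∑ d : Fin N, θ ^ ((d : ℕ) * 0) • (circulantBlock G σ H₀ d).map ((↑) : ℝ → ℂ)) =
      Complex.ofRealHom.mapMatrix
        ((starGraph G N σ H₀).lap + Matrix.vecMulVec (fun _ => (N : ℝ)) 1) := by
    ext x y
    rw [Matrix.sum_apply]
    simp only [mul_zero, pow_zero, one_smul, Matrix.map_apply, circulantBlock, Matrix.of_apply,
      RingHom.mapMatrix_apply, Matrix.add_apply, Complex.ofRealHom_eq_coe, Matrix.vecMulVec_apply,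
      Pi.one_apply, mul_one]
    rw [Fin.sum_univ_eq_sum_range
      (fun d => ((G.lap x ((σ ^ d) y) + 1 - schurB G σ H₀ x y : ℝ) : ℂ)) N,
      ← Complex.ofReal_sum, hσ.lap_starGraph hN hH₀ hL, Finset.sum_sub_distrib,
      Finset.sum_add_distrib]
    simp only [Finset.sum_const, Finset.card_range, nsmul_eq_mul, mul_one]
    congr 1
    ring
  rw [h, ← RingHom.map_det, WGraph.det_lap_add_vecMulVec, Complex.ofRealHom_eq_coe]
  congr 2
  simp only [Finset.sum_const, Finset.card_univ, nsmul_eq_mul, Pi.one_apply, mul_one]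
  ring

/-- The part of a block that does not depend on d is multiplied by ∑θ^{dt} = 0. -/
theorem IsOneNPeriodic.det_sum_circulantBlock (hσ : IsOneNPeriodic G N σ) (hN : 0 < N)
    (hH₀ : IsBasePart N σ H₀) (hθ : IsPrimitiveRoot θ N) {t : ℕ} (ht : t ≠ 0) (htN : t < N) :
    (∑ d : Fin N, θ ^ ((d : ℕ) * t) • (circulantBlock G σ H₀ d).map ((↑) : ℝ → ℂ)).det =
      (rootedDigraph G N σ H₀ θ t).tau none := by
  rw [hσ.tau_rootedDigraph hN hH₀ hθ]
  congr 1
  have hsum : ∑ d : Fin N, θ ^ ((d : ℕ) * t) = 0 := by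
    rw [Fin.sum_univ_eq_sum_range (fun d => θ ^ (d * t)) N]
    simp only [mul_comm _ t, pow_mul]
    rw [geom_sum_eq (hθ.pow_ne_one_of_pos_of_lt ht htN), ← pow_mul, mul_comm, pow_mul,
      hθ.pow_eq_one, one_pow, sub_self, zero_div]
  ext x y
  simp only [Matrix.sum_apply, Matrix.smul_apply, Matrix.map_apply, circulantBlock,
    Matrix.of_apply, smul_eq_mul, add_sub_assoc, Complex.ofReal_add, mul_add,
    Finset.sum_add_distrib]
  rw [← Finset.sum_mul, hsum, zero_mul, add_zero]

end FourierBlocks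

theorem theorem3p7 {V : Type*} [Fintype V] [DecidableEq V] (G : WGraph V ℝ)
    (hconn : G.graph.Connected) (hpos : ∀ e ∈ G.graph.edgeSet, 0 < G.weight e)
    (N : ℕ) (hN : 2 ≤ N) (σ : Equiv.Perm V) (hσ : IsOneNPeriodic G N σ)
    (hS : Nonempty (FixedVertex σ))
    (H₀ : Finset V) (hH₀ : IsBasePart N σ H₀)
    (θ : ℂ) (hθ : IsPrimitiveRoot θ N) :
    (G.tau : ℂ) = (((lapS G σ).det : ℝ) : ℂ) / (N : ℂ) * (((starGraph G N σ H₀).tau : ℝ) : ℂ)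
      * ∏ t ∈ Finset.Icc 1 (N - 1), (rootedDigraph G N σ H₀ θ t).tau none := by
  have hN0 : 0 < N := by omega
  have : NeZero N := ⟨hN0.ne'⟩
  have hV : Nonempty V := hconn.nonempty
  -- A moved vertex makes L_S invertible and H₀ nonempty, so that m can be cancelled at the end.
  obtain ⟨h, hh⟩ : ∃ h, σ h ≠ h := by
    by_contra! hfix
    have h1 : σ = 1 := Equiv.ext hfix
    have h2 := hσ.order
    rw [h1, orderOf_one] at h2
    omega
  have hH : Nonempty H₀ := by
    have : h ∈ (Finset.range N).biUnion (copy σ H₀) := by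
      rw [hH₀.cover]
      exact Finset.mem_filter.2 ⟨Finset.mem_univ _, hh⟩
    obtain ⟨i, -, hm⟩ := Finset.mem_biUnion.1 this
    obtain ⟨x, hx, -⟩ := Finset.mem_map.1 hm
    exact ⟨x, hx⟩
  have hL : IsUnit (lapS G σ).det := (lapS_det_pos hconn hpos σ hh).ne'.isUnit
  have hcirc := hθ.det_block_circulant
    fun d : Fin N => (circulantBlock G σ H₀ d).map ((↑) : ℝ → ℂ)
  have hmap : (Matrix.of fun p q : H₀ × Fin N =>
        ((circulantBlock G σ H₀ ((q.2 - p.2 : Fin N) : ℕ)).map ((↑) : ℝ → ℂ)) p.1 q.1) =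
      Complex.ofRealHom.mapMatrix (Matrix.of fun p q : H₀ × Fin N =>
        circulantBlock G σ H₀ ((q.2 - p.2 : Fin N) : ℕ) p.1 q.1) := by
    ext p q
    rfl
  rw [hmap, ← RingHom.map_det, Fin.prod_univ_eq_prod_range
    (fun t => (∑ d : Fin N, θ ^ ((d : ℕ) * t) •
      (circulantBlock G σ H₀ d).map ((↑) : ℝ → ℂ)).det) N] at hcirc
  have hrange : Finset.range N = insert 0 (Finset.Icc 1 (N - 1)) := by
    ext i
    simp only [Finset.mem_range, Finset.mem_insert, Finset.mem_Icc]
    omega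
  have hprod : ∀ t ∈ Finset.Icc 1 (N - 1), (∑ d : Fin N, θ ^ ((d : ℕ) * t) •
      (circulantBlock G σ H₀ d).map ((↑) : ℝ → ℂ)).det =
        (rootedDigraph G N σ H₀ θ t).tau none := fun t ht => by
    have ht := Finset.mem_Icc.1 ht
    exact hσ.det_sum_circulantBlock hN0 hH₀ hθ (by omega) (by omega)
  rw [hrange, Finset.prod_insert (by simp), hσ.det_sum_circulantBlock_zero hN0 hH₀ hL,
    Finset.prod_congr rfl hprod, Complex.ofRealHom_eq_coe] at hcirc
  have hschur := congrArg ((↑) : ℝ → ℂ) (hσ.det_schur hH₀ hL)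
  rw [Complex.ofReal_mul (lapS G σ).det, hcirc] at hschur
  have hNC : (N : ℂ) ≠ 0 := Nat.cast_ne_zero.2 hN0.ne'
  have hmC : (Fintype.card H₀ : ℂ) ≠ 0 := Nat.cast_ne_zero.2 Fintype.card_ne_zero
  push_cast at hschur
  refine mul_left_cancel₀ (pow_ne_zero 2 (mul_ne_zero hmC hNC)) (hschur.trans ?_)
  field_simp
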